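/- **Setting.** Let $a,\rho,q_1,q_2,p_1,p_2,\delta>0$, $b=a/\rho$, $N\ge 1$ an integer, $T=N\delta$, $t_0\in\mathbb R$ and $t_k=t_0+k\delta$. Let $\mathbb U=\{(v,\omega):|v|/a+|\omega|/b\le 1\}$. The reference $\xi_r=(x_r,y_r,\theta_r)$ satisfies $\dot\xi_r=(v_r\cos\theta_r,v_r\sin\theta_r,\omega_r)$ on $[t_0,\infty)$ with a measurable input $u_r=(v_r,\omega_r)\in\mathbb U$ and $|v_r|<a/\sqrt2$. The follower, described by its head position $p_{fh}$ and its orientation $\theta_f$, $\xi_{fh}=(p_{fh},\theta_f)$, obeys $$\dot\xi_{fh}=f_h(\xi_{fh},u_f)+(d_p,0),\qquad f_h\big((x,y,\theta),(v,\omega)\big)=(v\cos\theta-\rho\omega\sin\theta,\ v\sin\theta+\rho\omega\cos\theta,\ \omega),$$ with a measurable disturbance $d_p(t)\in\mathbb R^2$, $\|d_p(t)\|\le\eta$, where $\eta\ge0$. Solutions are absolutely continuous and satisfy the equations in integral form, and orientations are real valued. The tracking error is $p_{rf}=R(-\theta_f)(p_r-p_{fh})$, where $p_r=(x_r,y_r)$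 and $R(\theta)$ is the rotation by $\theta$. A tilde denotes the same quantities for the nominal system $\dot{\tilde\xi}_{fh}=f_h(\tilde\xi_{fh},\tilde u_f)$, and $$\tilde u_{rf}=(-\tilde v_f+v_r\cos(\theta_r-\tilde\theta_f),\ -\rho\tilde\omega_f+v_r\sin(\theta_r-\tilde\theta_f)).$$ With $Q=\mathrm{diag}(q_1,q_2)$ and $P=\mathrm{diag}(p_1,p_2)$ the cost at time $t_k$ is $$J=\int_{t_k}^{t_k+T}\big(\|\tilde p_{rf}\|_Q^2+\|\tilde u_{rf}\|_P^2\big)\,d\tau+\tfrac12\|\tilde p_{rf}(t_k+T)\|^2 .$$ Assume $p_iq_i<\frac14$ and let $\tilde k_i\in\Big(\frac{1-\sqrt{1-4p_iq_i}}{2p_i},\frac{1+\sqrt{1-4p_iq_i}}{2p_i}\Big)$ for $i=1,2$. Put $$\tilde k=\min\{\tilde k_1,\tilde k_2\},\quad \lambda_r=\frac{\sqrt2}{a}\sup_{t\ge t_0}|v_r(t)|,\quad r=\frac{a(1-\lambda_r)}{\sqrt{\tilde k_1^2+\tilde k_2^2}},\quad 0<\varepsilon<r.$$ **Problem 2 at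 $t_k$ in the measured state $\xi_{fh}(t_k)$.** Minimize $J$ over measurable inputs $\tilde u_f$ on $[t_k,t_k+T]$ with nominal trajectories $\tilde\xi_{fh}$ such that $\tilde\xi_{fh}(t_k)=\xi_{fh}(t_k)$, $\tilde u_f(\tau)\in\mathbb U$ on $[t_k,t_k+T]$, $\|\tilde p_{rf}(\tau)\|\le\frac{rT}{\tau-t_k}$ for $\tau\in(t_k,t_k+T]$, and $\tilde p_{rf}(t_k+T)\in\Omega_\varepsilon=\{p:\|p\|\le\varepsilon\}$. **NRMPC algorithm.** At each $t_k$ the nominal state is reset to the measured state, Problem 2 is solved, and the minimizing input is applied to the disturbed follower in open loop on $[t_k,t_{k+1}]$. **Theorem 2.** Suppose that $$\eta\le\frac{e^{-aT}}{\delta}(r-\varepsilon),\qquad \tilde k\,\delta\ge\ln\frac r\varepsilon,\qquad \varepsilon\ge\frac{r(T-\delta)}{T}.$$ (i) If Problem 2 is feasible at $t_0$, then, along every closed-loop trajectory of the NRMPC algorithm, it is feasible at every later sampling instant: whenever the steps at $t_0,\dots,t_{n-1}$ have been carried out, Problem 2 is feasible at $t_n$ in the state $\xi_{fh}(t_n)$.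 (ii) Let $\underline q=\min\{q_1,q_2\}$ and $q=\sqrt{\max\{q_1,q_2\}}$ (the least $q$ with $\|x\|_Q\le q\|x\|$ for all $x$). If $$\underline q\,\varepsilon^2>\tfrac12\eta e^{aT}(r+\varepsilon)+\frac{q^2\eta^2\delta}{2a}\big(e^{2aT}-e^{2a\delta}\big)+\frac{2q^2\eta r}{\sqrt2\,a}\Big(\frac{T^2}{\delta}-T\Big)^{1/2}\big(e^{2aT}-e^{2a\delta}\big)^{1/2},$$ then the closed-loop tracking system is input-to-state stable on the set of initially feasible states: there are a $\mathcal{KL}$ function $\beta$ and a $\mathcal K$ function $\gamma$ such that, for every $\eta'\in[0,\eta]$, every measurable disturbance with $\|d_p(t)\|\le\eta'$ for $t\ge t_0$, and every closed-loop trajectory starting in a state in which Problem 2 is feasible at $t_0$, $$\|p_{rf}(t)\|\le\beta(\|p_{rf}(t_0)\|,t-t_0)+\gamma(\eta')$$ for all $t\ge t_0$ in the time interval $[t_0,t_n]$ or $[t_0,\infty)$ on which the trajectory is given. -/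

import Mathlib

open Real Set Filter Topology MeasureTheory

noncomputable section

namespace NRMPC

/-- Vectors of the plane: positions, inputs `[v, ω]`, tracking errors. -/
abbrev E2 : Type := EuclideanSpace ℝ (Fin 2)

/-- Configurations `[x, y, θ]`; the orientation is a real number (a continuous lift of the angle). -/
abbrev E3 : Type := EuclideanSpace ℝ (Fin 3)

/-- The numerical data: maximal wheel speed `a`, half wheelbase `ρ`, weights `Q = diag(q₁, q₂)` and
`P = diag(p₁, p₂)`, terminal feedback gains `k₁, k₂`, radius `ε` of the terminal ball, sampling
period `δ`, number `N` of sampling periods in the prediction horizon, initial time `t₀`. -/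
structure Params where
  a : ℝ
  ρ : ℝ
  q₁ : ℝ
  q₂ : ℝ
  p₁ : ℝ
  p₂ : ℝ
  k₁ : ℝ
  k₂ : ℝ
  ε : ℝ
  δ : ℝ
  N : ℕ
  t₀ : ℝ

/-- Standing conditions on the data, including those on the gains of the terminal controller. -/
structure Params.Admissible (P : Params) : Prop where
  a_pos : 0 < P.a
  ρ_pos : 0 < P.ρ
  q₁_pos : 0 < P.q₁
  q₂_pos : 0 < P.q₂
  p₁_pos : 0 < P.p₁
  p₂_pos : 0 < P.p₂
  δ_pos : 0 < P.δ
  N_pos : 0 < P.N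
  pq₁ : P.p₁ * P.q₁ < 1 / 4
  pq₂ : P.p₂ * P.q₂ < 1 / 4
  k₁_mem : P.k₁ ∈ Ioo ((1 - √(1 - 4 * P.p₁ * P.q₁)) / (2 * P.p₁))
    ((1 + √(1 - 4 * P.p₁ * P.q₁)) / (2 * P.p₁))
  k₂_mem : P.k₂ ∈ Ioo ((1 - √(1 - 4 * P.p₂ * P.q₂)) / (2 * P.p₂))
    ((1 + √(1 - 4 * P.p₂ * P.q₂)) / (2 * P.p₂))

/-- The bound `b = a / ρ` on the angular velocity. -/
def Params.b (P : Params) : ℝ := P.a / P.ρ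

/-- The prediction horizon `T = N δ`. -/
def Params.T (P : Params) : ℝ := P.N * P.δ

/-- The sampling instants `t_k = t₀ + k δ`. -/
def Params.t (P : Params) (k : ℕ) : ℝ := P.t₀ + k * P.δ

/-- The diamond-shaped input set. -/
def Params.U (P : Params) : Set E2 := {u | |u 0| / P.a + |u 1| / P.b ≤ 1}

/-- The unicycle field. -/
def unicycle (ξ : E3) (u : E2) : E3 := !₂[u 0 * cos (ξ 2), u 0 * sin (ξ 2), u 1]

/-- The field of the head position kinematics. -/
def headField (ρ : ℝ) (ξ : E3) (u : E2) : E3 :=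
  !₂[u 0 * cos (ξ 2) - ρ * u 1 * sin (ξ 2), u 0 * sin (ξ 2) + ρ * u 1 * cos (ξ 2), u 1]

/-- `ξ` is an (absolutely continuous) solution of `ξ' = F(t, ξ)` on `[s, e]`, in integral form. -/
def IsSolution (F : ℝ → E3 → E3) (s e : ℝ) (ξ : ℝ → E3) : Prop :=
  ContinuousOn ξ (Icc s e) ∧ ∀ τ ∈ Icc s e, ξ τ = ξ s + ∫ σ in s..τ, F σ (ξ σ)

/-- A reference configuration `ξ = [x_r, y_r, θ_r]` and input `u = [v_r, ω_r]`. -/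
structure Reference where
  ξ : ℝ → E3
  u : ℝ → E2

/-- The reference is a unicycle trajectory on `[t₀, ∞)` with inputs in `U` and `|v_r| < a / √2`. -/
structure Reference.Admissible (ref : Reference) (P : Params) : Prop where
  measurable : Measurable ref.u
  mem_U : ∀ t, P.t₀ ≤ t → ref.u t ∈ P.U
  speed : ∀ t, P.t₀ ≤ t → |ref.u t 0| < P.a / √2
  solution : ∀ e, P.t₀ ≤ e → IsSolution (fun σ ζ => unicycle ζ (ref.u σ)) P.t₀ e ref.ξ

/-- `λ_r = (√2 / a) sup |v_r|`. -/
def lambdaR (P : Params) (ref : Reference) : ℝ :=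
  √2 / P.a * sSup ((fun t => |ref.u t 0|) '' Ici P.t₀)

/-- `r = a (1 - λ_r) / √(k₁² + k₂²)`. -/
def radius (P : Params) (ref : Reference) : ℝ :=
  P.a * (1 - lambdaR P ref) / √(P.k₁ ^ 2 + P.k₂ ^ 2)

/-- Tracking error of the head position in the frame of the follower: the vector
`p_r - p_fh` rotated by `-θ_f`. -/
def trackErr (ζr ζ : E3) : E2 :=
  !₂[cos (ζ 2) * (ζr 0 - ζ 0) + sin (ζ 2) * (ζr 1 - ζ 1),
    -sin (ζ 2) * (ζr 0 - ζ 0) + cos (ζ 2) * (ζr 1 - ζ 1)]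

/-- The input error `[-v_f + v_r cos θ_rf, -ρ ω_f + v_r sin θ_rf]`, `θ_rf = θ_r - θ_f`. -/
def inputErr (ρ : ℝ) (ζr : E3) (ur : E2) (ζ : E3) (u : E2) : E2 :=
  !₂[-u 0 + ur 0 * cos (ζr 2 - ζ 2), -(ρ * u 1) + ur 0 * sin (ζr 2 - ζ 2)]

/-- Stage cost `‖p‖_Q² + ‖w‖_P²`. -/
def stageCost (P : Params) (p w : E2) : ℝ :=
  P.q₁ * p 0 ^ 2 + P.q₂ * p 1 ^ 2 + (P.p₁ * w 0 ^ 2 + P.p₂ * w 1 ^ 2)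

/-- Terminal penalty. -/
def terminalCost (p : E2) : ℝ := 1 / 2 * ‖p‖ ^ 2

/-- The cost over `[s, s + T]` of a predicted state trajectory `ξ` with input `u`. -/
def cost (P : Params) (ref : Reference) (s : ℝ) (u : ℝ → E2) (ξ : ℝ → E3) : ℝ :=
  (∫ τ in s..(s + P.T), stageCost P (trackErr (ref.ξ τ) (ξ τ))
    (inputErr P.ρ (ref.ξ τ) (ref.u τ) (ξ τ) (u τ)))
  + terminalCost (trackErr (ref.ξ (s + P.T)) (ξ (s + P.T)))

/-- `(u, ξ)` satisfies all constraints of the optimal control problem posed at time `s` in the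
measured state `ζ`. (The robust state constraint is void at `τ = s`, where its bound is `+∞`.) -/
structure IsFeasiblePair (P : Params) (ref : Reference) (s : ℝ) (ζ : E3)
    (u : ℝ → E2) (ξ : ℝ → E3) : Prop where
  measurable : Measurable u
  initial : ξ s = ζ
  solution : IsSolution (fun σ x => headField P.ρ x (u σ)) s (s + P.T) ξ
  input : ∀ τ ∈ Icc s (s + P.T), u τ ∈ P.U
  state : ∀ τ ∈ Ioc s (s + P.T),
    ‖trackErr (ref.ξ τ) (ξ τ)‖ ≤ radius P ref * P.T / (τ - s)
  terminal : ‖trackErr (ref.ξ (s + P.T)) (ξ (s + P.T))‖ ≤ P.ε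

/-- The optimal control problem posed at time `s` in the measured state `ζ` is feasible. -/
def Feasible (P : Params) (ref : Reference) (s : ℝ) (ζ : E3) : Prop :=
  ∃ u ξ, IsFeasiblePair P ref s ζ u ξ

/-- `(u, ξ)` solves the optimal control problem posed at time `s` in the measured state `ζ`. -/
def IsOptimalPair (P : Params) (ref : Reference) (s : ℝ) (ζ : E3)
    (u : ℝ → E2) (ξ : ℝ → E3) : Prop :=
  IsFeasiblePair P ref s ζ u ξ ∧
    ∀ u' ξ', IsFeasiblePair P ref s ζ u' ξ' → cost P ref s u ξ ≤ cost P ref s u' ξ'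

/-- Disturbances `d_p` of the head position (the orientation is undisturbed) bounded by `η`. -/
def IsDisturbance (P : Params) (η : ℝ) (d : ℝ → E2) : Prop :=
  Measurable d ∧ ∀ t, P.t₀ ≤ t → ‖d t‖ ≤ η

/-- The `k`-th step of the NRMPC algorithm: at `t_k` the nominal state is reset to the measured state
`ξ t_k`, the problem is solved, and the optimal input obtained is applied in open loop to the
disturbed system during `[t_k, t_{k+1}]`. -/
def Step (P : Params) (ref : Reference) (d : ℝ → E2) (ξ : ℝ → E3) (k : ℕ) : Prop :=
  ∃ u ξn, IsOptimalPair P ref (P.t k) (ξ (P.t k)) u ξn ∧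
    IsSolution (fun σ x => headField P.ρ x (u σ) + !₂[d σ 0, d σ 1, 0]) (P.t k) (P.t (k + 1)) ξ

/-- `ξ` is a closed-loop trajectory of the disturbed system on `[t₀, t_n]`: the first `n` steps of
the algorithm could be and have been carried out. -/
def IsRun (P : Params) (ref : Reference) (d : ℝ → E2) (ξ : ℝ → E3) (n : ℕ) : Prop :=
  ∀ k < n, Step P ref d ξ k

/-- Class `𝒦` functions. -/
def IsClassK (γ : ℝ → ℝ) : Prop :=
  ContinuousOn γ (Ici 0) ∧ StrictMonoOn γ (Ici 0) ∧ γ 0 = 0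

/-- Class `𝒦ℒ` functions. -/
def IsClassKL (β : ℝ → ℝ → ℝ) : Prop :=
  (∀ t, 0 ≤ t → IsClassK fun s => β s t) ∧
    ∀ s, 0 ≤ s → AntitoneOn (β s) (Ici 0) ∧ Tendsto (β s) atTop (𝓝 0)

/-- Input-to-state stability of the closed-loop tracking error on the set of initially feasible
states, for disturbances up to the level `η`: the functions `β` and `γ` serve all initial states and
all disturbances, and the bound is in terms of the actual disturbance level `η' ≤ η`. The estimate
holds on every interval `[t₀, t_n]` on which the closed-loop trajectory is given, in particular for
all `t ≥ t₀` if the trajectory is given on `[t₀, ∞)`. -/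
def IsISS (P : Params) (ref : Reference) (η : ℝ) : Prop :=
  ∃ (β : ℝ → ℝ → ℝ) (γ : ℝ → ℝ), IsClassKL β ∧ IsClassK γ ∧
    ∀ η' ∈ Icc 0 η, ∀ (d : ℝ → E2) (ξ : ℝ → E3), IsDisturbance P η' d →
      Feasible P ref P.t₀ (ξ P.t₀) →
      ∀ n, IsRun P ref d ξ n → ∀ t ∈ Icc P.t₀ (P.t n),
        ‖trackErr (ref.ξ t) (ξ t)‖
          ≤ β ‖trackErr (ref.ξ P.t₀) (ξ P.t₀)‖ (t - P.t₀) + γ η'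

/-- The least `q` with `‖x‖_Q ≤ q ‖x‖` for all `x`. -/
def qNorm (P : Params) : ℝ := √(max P.q₁ P.q₂)

end NRMPC

end

/-!
The proof rests on two properties of the kinematics. In the inertial frame the tracking error moves
with the rotated input error (`norm_inputErr`, `IsArc.posErr_sub_eq`), and the kinematics are
invariant under translations of the head position (`IsArc.add_const`). As the orientation is not
disturbed, a disturbance of level `η` displaces the head during one period by at most `η δ`
(`IsArc.norm_posErr_sub_le_of_disturbed`), and the rest of the optimal input keeps this displacement
constant in time.

Recursive feasibility. The candidate at `t_{k+1}` is the rest of the optimal input followed by the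
terminal controller, for which the input error is `-(k₁ p₀, k₂ p₁)`. At `t_k + T` its tracking error
is at most `ε + η δ ≤ r`; the radius `r` is such that the terminal controller is admissible on the
disc of radius `r`, and one period of it leads into the disc of radius `ε`
(`exists_terminal_arc`, `IsFeasiblePair.exists_shifted`). The closed loop of the terminal controller
is an equation with measurable time dependence, solved by a contraction argument
(`exists_integral_curve_of_lipschitz`) after the tracking error in the controller has been clipped to
the disc of radius `r`, which the solution never leaves.

Stability. The optimal cost `V_k` at `t_k` is a Lyapunov function. Let `p_k` be the tracking error at
`t_k`.
* The cost of one period is at least `c ‖p_k‖²`, since an error that is removed is paid for by the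
  input error (`IsArc.mul_norm_sq_le_runCost`).
* `V_k ≤ C ‖p_k‖²`: in the disc of radius `r` the terminal controller costs at most `‖p_k‖² / 2`,
  and the cost of all feasible pairs is bounded (`IsOptimalPair.cost_le`).
* By comparison with the candidate, `V_{k+1} ≤ V_k - c ‖p_k‖² + g η'`, because the terminal penalty
  pays for the terminal controller and the displacement changes the cost by `O(η')`
  (`exists_feasible_succ`).

Hence `V_k` decays geometrically to a multiple of `η'` (`le_geometric_add`), and between the sampling
instants `‖p‖ ≤ √(B V_k) + δ η'`. This gives `β (s, t) = A s exp (-ν t)` and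
`γ (x) = δ x + G √x`.
-/

noncomputable section

namespace NRMPC

/-! ### Differential equations with measurable time dependence -/

section

/-- Global solutions of the initial value problem for a bounded field that is Lipschitz in the state
but only measurable in time, in integral form. Multiplied by `exp (-(L (τ - s)))` with `L = K + 1`,
the Picard operator is a contraction of `C([s, e], E)` with ratio `K / L`. -/
theorem exists_integral_curve_of_lipschitz {E : Type*} [NormedAddCommGroup E] [NormedSpace ℝ E]
    [CompleteSpace E] {F : ℝ → E → E} {s e K M : ℝ} (hse : s ≤ e) (hK : 0 ≤ K)
    (hmeas : ∀ x : ℝ → E, Continuous x → StronglyMeasurable fun σ => F σ (x σ))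
    (hbdd : ∀ σ ∈ Icc s e, ∀ x, ‖F σ x‖ ≤ M)
    (hlip : ∀ σ ∈ Icc s e, ∀ x y, ‖F σ x - F σ y‖ ≤ K * ‖x - y‖) (ζ : E) :
    ∃ x : ℝ → E, Continuous x ∧ ∀ τ ∈ Icc s e, x τ = ζ + ∫ σ in s..τ, F σ (x σ) := by
  have hint : ∀ x : ℝ → E, Continuous x → ∀ τ ∈ Icc s e,
      IntervalIntegrable (fun σ => F σ (x σ)) volume s τ := by
    intro x hx τ hτ
    rw [intervalIntegrable_iff_integrableOn_Ioc_of_le hτ.1]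
    refine Measure.integrableOn_of_bounded (M := M) (by simp)
      (hmeas x hx).aestronglyMeasurable ?_
    filter_upwards [ae_restrict_mem measurableSet_Ioc] with σ hσ
    exact hbdd σ ⟨hσ.1.le, hσ.2.trans hτ.2⟩ _
  set L : ℝ := K + 1 with hL
  have hLpos : 0 < L := by positivity
  let ext : C(Icc s e, E) → ℝ → E := fun g σ => exp (L * (σ - s)) • g (projIcc s e hse σ)
  have hext : ∀ g, Continuous (ext g) := fun g => by
    have := g.continuous.comp (continuous_projIcc (h := hse))
    exact Continuous.smul (by fun_prop) this
  have hcont : ∀ g : C(Icc s e, E), Continuous fun τ : Icc s e =>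
      exp (-(L * ((τ : ℝ) - s))) • (ζ + ∫ σ in s..(τ : ℝ), F σ (ext g σ)) := by
    intro g
    have h1 : ContinuousOn (fun τ => ∫ σ in s..τ, F σ (ext g σ)) (Icc s e) := by
      have h2 := hint (ext g) (hext g) e ⟨hse, le_rfl⟩
      rw [intervalIntegrable_iff_integrableOn_Icc_of_le hse] at h2
      have := intervalIntegral.continuousOn_primitive_interval (a := s) (b := e) (μ := volume)
        (f := fun σ => F σ (ext g σ)) (by rwa [uIcc_of_le hse])
      rwa [uIcc_of_le hse] at this
    have h3 := continuousOn_iff_continuous_domRestrict.1 h1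
    exact Continuous.smul (by fun_prop) (continuous_const.add h3)
  let Φ : C(Icc s e, E) → C(Icc s e, E) := fun g => ⟨_, hcont g⟩
  have hΦ : ContractingWith (Real.toNNReal (K / L)) Φ := by
    have hKL : 0 ≤ K / L := by positivity
    refine ⟨?_, ?_⟩
    · rw [Real.toNNReal_lt_one, div_lt_one hLpos]
      linarith
    refine LipschitzWith.of_dist_le_mul fun g h => ?_
    rw [Real.coe_toNNReal _ hKL]
    refine (ContinuousMap.dist_le (by positivity)).2 fun τ => ?_
    have hτ := τ.2
    have hpt : ∀ σ ∈ Ioc s (τ : ℝ), ‖F σ (ext g σ) - F σ (ext h σ)‖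
        ≤ K * dist g h * exp (L * (σ - s)) := by
      intro σ hσ
      have h1 := hlip σ ⟨hσ.1.le, hσ.2.trans hτ.2⟩ (ext g σ) (ext h σ)
      have h2 : ‖ext g σ - ext h σ‖ ≤ exp (L * (σ - s)) * dist g h := by
        simp only [ext]
        rw [← smul_sub, norm_smul, Real.norm_of_nonneg (exp_pos _).le, ← dist_eq_norm]
        gcongr
        exact ContinuousMap.dist_apply_le_dist _
      calc _ ≤ _ := h1
        _ ≤ K * (exp (L * (σ - s)) * dist g h) := by gcongr
        _ = _ := by ring
    have hI : ‖∫ σ in s..(τ : ℝ), (F σ (ext g σ) - F σ (ext h σ))‖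
        ≤ ∫ σ in s..(τ : ℝ), K * dist g h * exp (L * (σ - s)) :=
      intervalIntegral.norm_integral_le_of_norm_le hτ.1
        (Eventually.of_forall fun σ hσ => hpt σ hσ)
        (Continuous.intervalIntegrable (by fun_prop) _ _)
    have hE : ∫ σ in s..(τ : ℝ), K * dist g h * exp (L * (σ - s))
        = K * dist g h * ((exp (L * ((τ : ℝ) - s)) - 1) / L) := by
      rw [intervalIntegral.integral_const_mul]
      congr 1
      have hd : ∀ σ ∈ uIcc s (τ : ℝ), HasDerivAt (fun σ => exp (L * (σ - s)) / L)
          (exp (L * (σ - s))) σ := by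
        intro σ _
        have := ((((hasDerivAt_id σ).sub_const s).const_mul L).exp).div_const L
        refine this.congr_deriv ?_
        field_simp
        simp
      rw [intervalIntegral.integral_eq_sub_of_hasDerivAt hd
        (Continuous.intervalIntegrable (by fun_prop) _ _)]
      simp
      ring
    calc dist (Φ g τ) (Φ h τ)
        = exp (-(L * ((τ : ℝ) - s)))
          * ‖∫ σ in s..(τ : ℝ), (F σ (ext g σ) - F σ (ext h σ))‖ := by
          rw [dist_eq_norm]
          simp only [Φ, ContinuousMap.coe_mk]
          rw [← smul_sub, norm_smul, Real.norm_of_nonneg (exp_pos _).le, add_sub_add_left_eq_sub,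
            intervalIntegral.integral_sub (hint _ (hext g) _ hτ) (hint _ (hext h) _ hτ)]
      _ ≤ exp (-(L * ((τ : ℝ) - s)))
          * (K * dist g h * (exp (L * ((τ : ℝ) - s)) / L)) := by
          rw [hE] at hI
          refine mul_le_mul_of_nonneg_left (hI.trans ?_) (exp_pos _).le
          gcongr
          linarith
      _ = K / L * dist g h := by
          rw [exp_neg]
          field_simp
  have : Nonempty (Icc s e) := ⟨⟨s, le_rfl, hse⟩⟩
  have hfix := hΦ.fixedPoint_isFixedPt
  set g := ContractingWith.fixedPoint Φ hΦ
  refine ⟨ext g, hext g, fun τ hτ => ?_⟩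
  have h1 : g ⟨τ, hτ⟩ = exp (-(L * (τ - s))) • (ζ + ∫ σ in s..τ, F σ (ext g σ)) := by
    conv_lhs => rw [← hfix]
    rfl
  calc ext g τ = exp (L * (τ - s)) • g ⟨τ, hτ⟩ := by
        simp only [ext, projIcc_of_mem hse hτ]
    _ = _ := by rw [h1, smul_smul, ← exp_add]; simp

end

/-! ### Tracking errors, inputs, and integrals -/

section

/-- The tracking error in the inertial frame. -/
def posErr (ζr ζ : E3) : E2 := !₂[ζr 0 - ζ 0, ζr 1 - ζ 1]

/-- The velocity of the inertial tracking error `posErr`, as a function of the states and inputs. -/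
def velErr (ρ : ℝ) (ζr : E3) (ur : E2) (ζ : E3) (u : E2) : E2 :=
  !₂[ur 0 * cos (ζr 2) - (u 0 * cos (ζ 2) - ρ * u 1 * sin (ζ 2)),
    ur 0 * sin (ζr 2) - (u 0 * sin (ζ 2) + ρ * u 1 * cos (ζ 2))]

lemma norm_sq_E2 (p : E2) : ‖p‖ ^ 2 = p 0 ^ 2 + p 1 ^ 2 := by
  rw [EuclideanSpace.norm_sq_eq]
  simp [Fin.sum_univ_two]

/-- Passing between the inertial and the follower frame is a rotation. -/
lemma norm_trackErr (ζr ζ : E3) : ‖trackErr ζr ζ‖ = ‖posErr ζr ζ‖ := by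
  rw [← sq_eq_sq₀ (norm_nonneg _) (norm_nonneg _), norm_sq_E2, norm_sq_E2]
  simp [trackErr, posErr]
  linear_combination ((ζr 0 - ζ 0) ^ 2 + (ζr 1 - ζ 1) ^ 2) * sin_sq_add_cos_sq (ζ 2)

/-- The input error is the velocity of the inertial tracking error in the frame of the follower. -/
lemma norm_inputErr (ρ : ℝ) (ζr : E3) (ur : E2) (ζ : E3) (u : E2) :
    ‖inputErr ρ ζr ur ζ u‖ = ‖velErr ρ ζr ur ζ u‖ := by
  rw [← sq_eq_sq₀ (norm_nonneg _) (norm_nonneg _), norm_sq_E2, norm_sq_E2]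
  simp [inputErr, velErr, cos_sub, sin_sub]
  linear_combination (-(u 0 ^ 2 + (ρ * u 1) ^ 2)) * sin_sq_add_cos_sq (ζ 2)
    + (ur 0) ^ 2 * (cos (ζr 2) ^ 2 + sin (ζr 2) ^ 2) * sin_sq_add_cos_sq (ζ 2)

lemma abs_coord_le_norm {n : ℕ} (x : EuclideanSpace ℝ (Fin n)) (i : Fin n) : |x i| ≤ ‖x‖ :=
  PiLp.norm_apply_le x i

lemma norm_E2_le (p : E2) : ‖p‖ ≤ |p 0| + |p 1| := by
  refine abs_le_of_sq_le_sq' ?_ (by positivity) |>.2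
  rw [norm_sq_E2, ← sq_abs (p 0), ← sq_abs (p 1)]
  nlinarith [abs_nonneg (p 0), abs_nonneg (p 1)]

lemma norm_E3_le (p : E3) : ‖p‖ ≤ |p 0| + |p 1| + |p 2| := by
  refine abs_le_of_sq_le_sq' ?_ (by positivity) |>.2
  rw [EuclideanSpace.norm_sq_eq, Fin.sum_univ_three]
  simp only [Real.norm_eq_abs]
  nlinarith [mul_nonneg (abs_nonneg (p 0)) (abs_nonneg (p 1)),
    mul_nonneg (abs_nonneg (p 0)) (abs_nonneg (p 2)),
    mul_nonneg (abs_nonneg (p 1)) (abs_nonneg (p 2))]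

section Inputs
variable {P : Params}

lemma mem_U_iff (ha : 0 < P.a) (u : E2) :
    u ∈ P.U ↔ |u 0| + P.ρ * |u 1| ≤ P.a := by
  have : |u 0| / P.a + |u 1| / P.b = (|u 0| + P.ρ * |u 1|) / P.a := by
    rw [Params.b]
    field_simp
  rw [Params.U, mem_ofPred_eq, this, div_le_one ha]

lemma norm_le_of_mem_U (ha : 0 < P.a) (hρ : 0 < P.ρ) {u : E2} (hu : u ∈ P.U) :
    ‖u‖ ≤ P.a + P.b := by
  rw [mem_U_iff ha] at hu
  have h0 : |u 0| ≤ P.a := by nlinarith [mul_nonneg hρ.le (abs_nonneg (u 1))]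
  have h1 : |u 1| ≤ P.b := by
    rw [Params.b, le_div_iff₀ hρ]
    linarith [abs_nonneg (u 0)]
  linarith [norm_E2_le u]

lemma norm_inputErr_le (ha : 0 < P.a) (hρ : 0 < P.ρ) {u ur : E2} (hu : u ∈ P.U) (hur : ur ∈ P.U)
    (ζr ζ : E3) : ‖inputErr P.ρ ζr ur ζ u‖ ≤ 4 * P.a := by
  rw [mem_U_iff ha] at hu hur
  have h1 := mul_nonneg hρ.le (abs_nonneg (u 1))
  have h2 := mul_nonneg hρ.le (abs_nonneg (ur 1))
  have h3 := abs_nonneg (u 0)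
  have h4 := abs_nonneg (ur 0)
  have hc : |ur 0 * cos (ζr 2 - ζ 2)| ≤ |ur 0| := by
    rw [abs_mul]
    exact mul_le_of_le_one_right h4 (abs_cos_le_one _)
  have hs : |ur 0 * sin (ζr 2 - ζ 2)| ≤ |ur 0| := by
    rw [abs_mul]
    exact mul_le_of_le_one_right h4 (abs_sin_le_one _)
  refine (norm_E2_le _).trans ?_
  have e0 : |inputErr P.ρ ζr ur ζ u 0| ≤ |u 0| + |ur 0| := by
    simp only [inputErr]
    refine (abs_add_le _ _).trans ?_
    rw [abs_neg]
    gcongr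
  have e1 : |inputErr P.ρ ζr ur ζ u 1| ≤ P.ρ * |u 1| + |ur 0| := by
    simp only [inputErr]
    refine (abs_add_le _ _).trans ?_
    rw [abs_neg, abs_mul, abs_of_pos hρ]
    gcongr
  linarith

end Inputs

lemma continuous_headField (ρ : ℝ) : Continuous fun z : E3 × E2 => headField ρ z.1 z.2 := by
  unfold headField
  fun_prop

lemma continuous_unicycle : Continuous fun z : E3 × E2 => unicycle z.1 z.2 := by
  unfold unicycle
  fun_prop

lemma continuous_trackErr : Continuous fun z : E3 × E3 => trackErr z.1 z.2 := by
  unfold trackErr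
  fun_prop

lemma continuous_inputErr (ρ : ℝ) :
    Continuous fun z : (E3 × E3) × (E2 × E2) => inputErr ρ z.1.1 z.2.1 z.1.2 z.2.2 := by
  unfold inputErr
  fun_prop

lemma continuous_velErr (ρ : ℝ) :
    Continuous fun z : (E3 × E3) × (E2 × E2) => velErr ρ z.1.1 z.2.1 z.1.2 z.2.2 := by
  unfold velErr
  fun_prop

lemma continuous_stageCost (P : Params) : Continuous fun z : E2 × E2 => stageCost P z.1 z.2 := by
  unfold stageCost
  fun_prop

/-- The integrands of the state equations and of the costs are continuous functions of a continuous
state and a bounded measurable input. -/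
lemma intervalIntegrable_comp_of_bounded {X Y G : Type*} [NormedAddCommGroup X]
    [NormedAddCommGroup Y] [ProperSpace Y] [MeasurableSpace Y] [BorelSpace Y]
    [SecondCountableTopology Y] [NormedAddCommGroup G] {H : X × Y → G} (hH : Continuous H)
    {a b C : ℝ} (hab : a ≤ b) {ξ : ℝ → X} (hξ : ContinuousOn ξ (Icc a b)) {u : ℝ → Y}
    (hu : Measurable u) (hb : ∀ σ ∈ Icc a b, ‖u σ‖ ≤ C) :
    IntervalIntegrable (fun σ => H (ξ σ, u σ)) volume a b := by
  rw [intervalIntegrable_iff_integrableOn_Icc_of_le hab]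
  obtain ⟨M, hM⟩ := ((isCompact_Icc.image_of_continuousOn hξ).prod
    (isCompact_closedBall (0 : Y) C)).exists_bound_of_continuousOn hH.continuousOn
  refine IntegrableOn.of_bound (by simp) ?_ M ?_
  · exact hH.comp_aestronglyMeasurable
      ((hξ.aestronglyMeasurable_of_isCompact isCompact_Icc measurableSet_Icc).prodMk
        hu.aestronglyMeasurable)
  · filter_upwards [ae_restrict_mem measurableSet_Icc] with σ hσ
    exact hM _ ⟨mem_image_of_mem ξ hσ, by simpa using hb σ hσ⟩

lemma IsSolution.sub_eq {F : ℝ → E3 → E3} {s e : ℝ} {ξ : ℝ → E3} (h : IsSolution F s e ξ)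
    (hi : IntervalIntegrable (fun σ => F σ (ξ σ)) volume s e) {a b : ℝ} (ha : a ∈ Icc s e)
    (hb : b ∈ Icc s e) : ξ b - ξ a = ∫ σ in a..b, F σ (ξ σ) := by
  have hse := ha.1.trans ha.2
  have hm : ∀ x ∈ Icc s e, IntervalIntegrable (fun σ => F σ (ξ σ)) volume s x := fun x hx =>
    hi.mono_set (by rw [uIcc_of_le hx.1, uIcc_of_le hse]; exact Icc_subset_Icc_right hx.2)
  rw [h.2 b hb, h.2 a ha, add_sub_add_left_eq_sub,
    intervalIntegral.integral_interval_sub_left (hm b hb) (hm a ha)]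

lemma intervalIntegrable_coord {n : ℕ} {f : ℝ → EuclideanSpace ℝ (Fin n)} {a b : ℝ}
    (hf : IntervalIntegrable f volume a b) (i : Fin n) :
    IntervalIntegrable (fun σ => f σ i) volume a b :=
  let L : EuclideanSpace ℝ (Fin n) →L[ℝ] ℝ := EuclideanSpace.proj i
  ⟨L.integrable_comp hf.1, L.integrable_comp hf.2⟩

lemma integral_coord {n : ℕ} {f : ℝ → EuclideanSpace ℝ (Fin n)} {a b : ℝ}
    (hf : IntervalIntegrable f volume a b) (i : Fin n) :
    (∫ σ in a..b, f σ) i = ∫ σ in a..b, f σ i :=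
  ((EuclideanSpace.proj i : EuclideanSpace ℝ (Fin n) →L[ℝ] ℝ).intervalIntegral_comp_comm hf).symm

end

/-! ### Trajectories and running costs -/

section

/-- `ξ` is a trajectory of the undisturbed head kinematics on `[s, e]` whose measurable input `u`
takes values in `U`. -/
structure IsArc (P : Params) (u : ℝ → E2) (ξ : ℝ → E3) (s e : ℝ) : Prop where
  measurable : Measurable u
  solution : IsSolution (fun σ x => headField P.ρ x (u σ)) s e ξ
  input : ∀ τ ∈ Icc s e, u τ ∈ P.U

variable {P : Params} {ref : Reference} {u : ℝ → E2} {ξ : ℝ → E3} {s e a b : ℝ}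

lemma IsFeasiblePair.isArc {ζ : E3} (h : IsFeasiblePair P ref s ζ u ξ) :
    IsArc P u ξ s (s + P.T) := ⟨h.measurable, h.solution, h.input⟩

lemma Reference.Admissible.continuousOn (href : ref.Admissible P) :
    ContinuousOn ref.ξ (Ici P.t₀) := by
  intro t ht
  have h := (href.solution (t + 1) (by linarith [mem_Ici.1 ht])).1 t ⟨ht, by linarith⟩
  refine h.mono_of_mem_nhdsWithin ?_
  filter_upwards [self_mem_nhdsWithin,
    mem_nhdsWithin_of_mem_nhds (Iio_mem_nhds (show t < t + 1 by linarith))] with x h1 h2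
  exact ⟨h1, h2.le⟩

lemma Reference.Admissible.norm_u_le (href : ref.Admissible P) (hP : P.Admissible) {t : ℝ}
    (ht : P.t₀ ≤ t) : ‖ref.u t‖ ≤ P.a + P.b :=
  norm_le_of_mem_U hP.a_pos hP.ρ_pos (href.mem_U t ht)

lemma Reference.Admissible.intervalIntegrable (href : ref.Admissible P) (hP : P.Admissible)
    (ha : P.t₀ ≤ a) (hab : a ≤ b) :
    IntervalIntegrable (fun σ => unicycle (ref.ξ σ) (ref.u σ)) volume a b :=
  intervalIntegrable_comp_of_bounded continuous_unicycle hab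
    (href.continuousOn.mono (Icc_subset_Ici_self.trans (Ici_subset_Ici.2 ha))) href.measurable
    fun _ hσ => href.norm_u_le hP (ha.trans hσ.1)

lemma Reference.Admissible.sub_eq (href : ref.Admissible P) (hP : P.Admissible)
    (ha : P.t₀ ≤ a) (hab : a ≤ b) :
    ref.ξ b - ref.ξ a = ∫ σ in a..b, unicycle (ref.ξ σ) (ref.u σ) :=
  (href.solution b (ha.trans hab)).sub_eq (href.intervalIntegrable hP le_rfl (ha.trans hab))
    ⟨ha, hab⟩ ⟨ha.trans hab, le_rfl⟩

namespace IsArc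

lemma continuousOn (h : IsArc P u ξ s e) (ha : s ≤ a) (hb : b ≤ e) :
    ContinuousOn ξ (Icc a b) := h.solution.1.mono (Icc_subset_Icc ha hb)

lemma norm_input_le (h : IsArc P u ξ s e) (hP : P.Admissible) {τ : ℝ} (hτ : τ ∈ Icc s e) :
    ‖u τ‖ ≤ P.a + P.b := norm_le_of_mem_U hP.a_pos hP.ρ_pos (h.input τ hτ)

lemma intervalIntegrable_field (h : IsArc P u ξ s e) (hP : P.Admissible) (ha : s ≤ a)
    (hab : a ≤ b) (hb : b ≤ e) :
    IntervalIntegrable (fun σ => headField P.ρ (ξ σ) (u σ)) volume a b :=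
  intervalIntegrable_comp_of_bounded (continuous_headField P.ρ) hab (h.continuousOn ha hb)
    h.measurable fun _ hσ => h.norm_input_le hP ⟨ha.trans hσ.1, hσ.2.trans hb⟩

lemma sub_eq (h : IsArc P u ξ s e) (hP : P.Admissible) (ha : s ≤ a) (hab : a ≤ b) (hb : b ≤ e) :
    ξ b - ξ a = ∫ σ in a..b, headField P.ρ (ξ σ) (u σ) :=
  h.solution.sub_eq (h.intervalIntegrable_field hP le_rfl (ha.trans (hab.trans hb)) le_rfl)
    ⟨ha, hab.trans hb⟩ ⟨ha.trans hab, hb⟩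

lemma mono (h : IsArc P u ξ s e) (hP : P.Admissible) (ha : s ≤ a) (hb : b ≤ e) :
    IsArc P u ξ a b where
  measurable := h.measurable
  solution := ⟨h.continuousOn ha hb, fun τ hτ => by
    rw [← h.sub_eq hP ha hτ.1 (hτ.2.trans hb)]
    abel⟩
  input := fun τ hτ => h.input τ ⟨ha.trans hτ.1, hτ.2.trans hb⟩

/-- Along an arc, every continuous function of the states and inputs of the reference and of the
follower is integrable. -/
lemma intervalIntegrable_comp (h : IsArc P u ξ s e) (hP : P.Admissible) (href : ref.Admissible P)
    (hs : P.t₀ ≤ s) (hse : s ≤ e) {G : Type*} [NormedAddCommGroup G]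
    {H : (E3 × E3) × (E2 × E2) → G} (hH : Continuous H) :
    IntervalIntegrable (fun σ => H ((ref.ξ σ, ξ σ), (ref.u σ, u σ))) volume s e :=
  intervalIntegrable_comp_of_bounded (C := P.a + P.b) (ξ := fun σ => (ref.ξ σ, ξ σ))
    (u := fun σ => (ref.u σ, u σ)) hH hse
    ((href.continuousOn.mono (Icc_subset_Ici_self.trans (Ici_subset_Ici.2 hs))).prodMk
      (h.continuousOn le_rfl le_rfl)) (href.measurable.prodMk h.measurable)
    fun _ hσ => norm_prod_le_iff.2 ⟨href.norm_u_le hP (hs.trans hσ.1), h.norm_input_le hP hσ⟩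

lemma intervalIntegrable_velErr (h : IsArc P u ξ s e) (hP : P.Admissible)
    (href : ref.Admissible P) (hs : P.t₀ ≤ s) (hse : s ≤ e) :
    IntervalIntegrable (fun σ => velErr P.ρ (ref.ξ σ) (ref.u σ) (ξ σ) (u σ)) volume s e :=
  h.intervalIntegrable_comp hP href hs hse (continuous_velErr P.ρ)

lemma intervalIntegrable_stageCost (h : IsArc P u ξ s e) (hP : P.Admissible)
    (href : ref.Admissible P) (hs : P.t₀ ≤ s) (hse : s ≤ e) :
    IntervalIntegrable (fun σ => stageCost P (trackErr (ref.ξ σ) (ξ σ))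
      (inputErr P.ρ (ref.ξ σ) (ref.u σ) (ξ σ) (u σ))) volume s e :=
  h.intervalIntegrable_comp hP href hs hse ((continuous_stageCost P).comp
    ((continuous_trackErr.comp continuous_fst).prodMk (continuous_inputErr P.ρ)))

lemma intervalIntegrable_norm_trackErr_sq (h : IsArc P u ξ s e) (hP : P.Admissible)
    (href : ref.Admissible P) (hs : P.t₀ ≤ s) (hse : s ≤ e) :
    IntervalIntegrable (fun σ => ‖trackErr (ref.ξ σ) (ξ σ)‖ ^ 2) volume s e :=
  h.intervalIntegrable_comp hP href hs hse
    (((continuous_trackErr.comp continuous_fst).norm).pow 2)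

lemma intervalIntegrable_norm_inputErr (h : IsArc P u ξ s e) (hP : P.Admissible)
    (href : ref.Admissible P) (hs : P.t₀ ≤ s) (hse : s ≤ e) :
    IntervalIntegrable (fun σ => ‖inputErr P.ρ (ref.ξ σ) (ref.u σ) (ξ σ) (u σ)‖) volume s e :=
  h.intervalIntegrable_comp hP href hs hse (continuous_inputErr P.ρ).norm

lemma intervalIntegrable_norm_inputErr_sq (h : IsArc P u ξ s e) (hP : P.Admissible)
    (href : ref.Admissible P) (hs : P.t₀ ≤ s) (hse : s ≤ e) :
    IntervalIntegrable (fun σ => ‖inputErr P.ρ (ref.ξ σ) (ref.u σ) (ξ σ) (u σ)‖ ^ 2)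
      volume s e :=
  h.intervalIntegrable_comp hP href hs hse ((continuous_inputErr P.ρ).norm.pow 2)

lemma posErr_sub_eq (h : IsArc P u ξ s e) (hP : P.Admissible) (href : ref.Admissible P)
    (hs : P.t₀ ≤ s) (hse : s ≤ e) :
    posErr (ref.ξ e) (ξ e) - posErr (ref.ξ s) (ξ s)
      = ∫ σ in s..e, velErr P.ρ (ref.ξ σ) (ref.u σ) (ξ σ) (u σ) := by
  have hv := h.intervalIntegrable_velErr hP href hs hse
  have hf := h.intervalIntegrable_field hP le_rfl hse le_rfl
  have hr := href.intervalIntegrable hP hs hse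
  have h1 : ∀ i : Fin 3, (ref.ξ e i - ref.ξ s i) - (ξ e i - ξ s i)
      = ∫ σ in s..e, (unicycle (ref.ξ σ) (ref.u σ) i - headField P.ρ (ξ σ) (u σ) i) := by
    intro i
    have e1 := congrArg (· i) (href.sub_eq hP hs hse)
    have e2 := congrArg (· i) (h.sub_eq hP le_rfl hse le_rfl)
    simp only [PiLp.sub_apply, integral_coord hf, integral_coord hr] at e1 e2
    have c1 : IntervalIntegrable (fun σ => unicycle (ref.ξ σ) (ref.u σ) i) volume s e :=
      intervalIntegrable_coord hr i
    have c2 : IntervalIntegrable (fun σ => headField P.ρ (ξ σ) (u σ) i) volume s e :=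
      intervalIntegrable_coord hf i
    rw [intervalIntegral.integral_sub c1 c2, e1, e2]
  ext i
  rw [integral_coord hv]
  fin_cases i
  · have := h1 0
    simp [posErr, velErr, unicycle, headField] at this ⊢
    linarith
  · have := h1 1
    simp [posErr, velErr, unicycle, headField] at this ⊢
    linarith

lemma abs_norm_trackErr_sub_le (h : IsArc P u ξ s e) (hP : P.Admissible)
    (href : ref.Admissible P) (hs : P.t₀ ≤ s) (hse : s ≤ e) :
    |‖trackErr (ref.ξ e) (ξ e)‖ - ‖trackErr (ref.ξ s) (ξ s)‖|
      ≤ ∫ σ in s..e, ‖inputErr P.ρ (ref.ξ σ) (ref.u σ) (ξ σ) (u σ)‖ := by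
  simp only [norm_trackErr, norm_inputErr]
  refine (abs_norm_sub_norm_le _ _).trans ?_
  rw [h.posErr_sub_eq hP href hs hse]
  exact intervalIntegral.norm_integral_le_integral_norm hse

end IsArc

/-- The Cauchy–Schwarz inequality against the constant `1`. -/
lemma sq_integral_le {f : ℝ → ℝ} {s e : ℝ} (hse : s ≤ e) (hf : IntervalIntegrable f volume s e)
    (hf2 : IntervalIntegrable (fun σ => f σ ^ 2) volume s e) :
    (∫ σ in s..e, f σ) ^ 2 ≤ (e - s) * ∫ σ in s..e, f σ ^ 2 := by
  rcases hse.eq_or_lt with rfl | hlt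
  · simp
  set I := ∫ σ in s..e, f σ with hI
  have hL : 0 < e - s := sub_pos.2 hlt
  set c := I / (e - s) with hc
  have h0 : 0 ≤ ∫ σ in s..e, (f σ ^ 2 - (2 * c) * f σ + c ^ 2) :=
    intervalIntegral.integral_nonneg hse fun σ _ => by nlinarith [sq_nonneg (f σ - c)]
  rw [intervalIntegral.integral_add (hf2.sub (hf.const_mul _)) (by simp),
    intervalIntegral.integral_sub hf2 (hf.const_mul _), intervalIntegral.integral_const_mul,
    intervalIntegral.integral_const, ← hI, smul_eq_mul] at h0
  have h1 : c * (e - s) = I := by rw [hc]; field_simp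
  nlinarith

/-- The smallest of the weights `q₁, q₂, p₁, p₂`. -/
def minWeight (P : Params) : ℝ := min (min P.q₁ P.q₂) (min P.p₁ P.p₂)

lemma minWeight_pos (hP : P.Admissible) : 0 < minWeight P :=
  lt_min (lt_min hP.q₁_pos hP.q₂_pos) (lt_min hP.p₁_pos hP.p₂_pos)

lemma minWeight_mul_le_stageCost (P : Params) (p w : E2) :
    minWeight P * (‖p‖ ^ 2 + ‖w‖ ^ 2) ≤ stageCost P p w := by
  have h1 : minWeight P ≤ P.q₁ := (min_le_left _ _).trans (min_le_left _ _)
  have h2 : minWeight P ≤ P.q₂ := (min_le_left _ _).trans (min_le_right _ _)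
  have h3 : minWeight P ≤ P.p₁ := (min_le_right _ _).trans (min_le_left _ _)
  have h4 : minWeight P ≤ P.p₂ := (min_le_right _ _).trans (min_le_right _ _)
  rw [norm_sq_E2, norm_sq_E2, stageCost]
  nlinarith [mul_le_mul_of_nonneg_right h1 (sq_nonneg (p 0)),
    mul_le_mul_of_nonneg_right h2 (sq_nonneg (p 1)),
    mul_le_mul_of_nonneg_right h3 (sq_nonneg (w 0)),
    mul_le_mul_of_nonneg_right h4 (sq_nonneg (w 1))]

lemma stageCost_nonneg (hP : P.Admissible) (p w : E2) : 0 ≤ stageCost P p w :=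
  le_trans (mul_nonneg (minWeight_pos hP).le (by positivity)) (minWeight_mul_le_stageCost P p w)

lemma stageCost_le (hP : P.Admissible) (p w : E2) :
    stageCost P p w ≤ (P.q₁ + P.q₂) * ‖p‖ ^ 2 + (P.p₁ + P.p₂) * ‖w‖ ^ 2 := by
  rw [norm_sq_E2, norm_sq_E2, stageCost]
  nlinarith [mul_nonneg hP.q₁_pos.le (sq_nonneg (p 1)), mul_nonneg hP.q₂_pos.le (sq_nonneg (p 0)),
    mul_nonneg hP.p₁_pos.le (sq_nonneg (w 1)), mul_nonneg hP.p₂_pos.le (sq_nonneg (w 0))]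

/-- The running cost `∫ (‖p‖_Q² + ‖w‖_P²)` over `[s, e]`. -/
def runCost (P : Params) (ref : Reference) (u : ℝ → E2) (ξ : ℝ → E3) (s e : ℝ) : ℝ :=
  ∫ τ in s..e, stageCost P (trackErr (ref.ξ τ) (ξ τ))
    (inputErr P.ρ (ref.ξ τ) (ref.u τ) (ξ τ) (u τ))

lemma runCost_nonneg (hP : P.Admissible) (hse : s ≤ e) : 0 ≤ runCost P ref u ξ s e :=
  intervalIntegral.integral_nonneg hse fun _ _ => stageCost_nonneg hP _ _

namespace IsArc

lemma minWeight_mul_integral_le (h : IsArc P u ξ s e) (hP : P.Admissible)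
    (href : ref.Admissible P) (hs : P.t₀ ≤ s) (hse : s ≤ e) :
    minWeight P * ((∫ σ in s..e, ‖trackErr (ref.ξ σ) (ξ σ)‖ ^ 2)
      + ∫ σ in s..e, ‖inputErr P.ρ (ref.ξ σ) (ref.u σ) (ξ σ) (u σ)‖ ^ 2)
      ≤ runCost P ref u ξ s e := by
  have h1 := h.intervalIntegrable_norm_trackErr_sq hP href hs hse
  have h2 := h.intervalIntegrable_norm_inputErr_sq hP href hs hse
  rw [← intervalIntegral.integral_add h1 h2, ← intervalIntegral.integral_const_mul]
  exact intervalIntegral.integral_mono_on hse ((h1.add h2).const_mul _)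
    (h.intervalIntegrable_stageCost hP href hs hse)
    fun σ _ => minWeight_mul_le_stageCost P _ _

/-- The change of the tracking error is controlled by the input error, hence by the running cost. -/
lemma abs_norm_sub_sq_le (h : IsArc P u ξ s e) (hP : P.Admissible)
    (href : ref.Admissible P) (hs : P.t₀ ≤ s) {τ : ℝ} (hτ : τ ∈ Icc s e) :
    (‖trackErr (ref.ξ τ) (ξ τ)‖ - ‖trackErr (ref.ξ s) (ξ s)‖) ^ 2 ≤
      (e - s) * ∫ σ in s..e, ‖inputErr P.ρ (ref.ξ σ) (ref.u σ) (ξ σ) (u σ)‖ ^ 2 := by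
  have hse := hτ.1.trans hτ.2
  have h' := h.mono hP le_rfl hτ.2
  have h1 := h'.abs_norm_trackErr_sub_le hP href hs hτ.1
  have h2 : ∫ σ in s..τ, ‖inputErr P.ρ (ref.ξ σ) (ref.u σ) (ξ σ) (u σ)‖
      ≤ ∫ σ in s..e, ‖inputErr P.ρ (ref.ξ σ) (ref.u σ) (ξ σ) (u σ)‖ :=
    intervalIntegral.integral_mono_interval le_rfl hτ.1 hτ.2
      (Eventually.of_forall fun _ => norm_nonneg _)
      (h.intervalIntegrable_norm_inputErr hP href hs hse)
  have h3 := sq_integral_le hse (h.intervalIntegrable_norm_inputErr hP href hs hse)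
    (h.intervalIntegrable_norm_inputErr_sq hP href hs hse)
  refine le_trans ?_ h3
  rw [← sq_abs (_ - _)]
  exact pow_le_pow_left₀ (abs_nonneg _) (h1.trans h2) 2

lemma norm_sq_le_of_runCost (h : IsArc P u ξ s e) (hP : P.Admissible)
    (href : ref.Admissible P) (hs : P.t₀ ≤ s) {τ : ℝ} (hτ : τ ∈ Icc s e) :
    ‖trackErr (ref.ξ τ) (ξ τ)‖ ^ 2 ≤ 2 * ‖trackErr (ref.ξ s) (ξ s)‖ ^ 2
      + 2 * (e - s) / minWeight P * runCost P ref u ξ s e := by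
  have hse := hτ.1.trans hτ.2
  have h1 := h.abs_norm_sub_sq_le hP href hs hτ
  have h2 := h.minWeight_mul_integral_le hP href hs hse
  have hm := minWeight_pos hP
  have h3 : 0 ≤ ∫ σ in s..e, ‖trackErr (ref.ξ σ) (ξ σ)‖ ^ 2 :=
    intervalIntegral.integral_nonneg hse fun _ _ => by positivity
  set W := ∫ σ in s..e, ‖inputErr P.ρ (ref.ξ σ) (ref.u σ) (ξ σ) (u σ)‖ ^ 2
  have h4 : W ≤ runCost P ref u ξ s e / minWeight P := by
    rw [le_div_iff₀ hm]
    nlinarith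
  have h5 : (e - s) * W ≤ (e - s) * (runCost P ref u ξ s e / minWeight P) :=
    mul_le_mul_of_nonneg_left h4 (by linarith)
  have h6 : 2 * (e - s) / minWeight P * runCost P ref u ξ s e
      = 2 * ((e - s) * (runCost P ref u ξ s e / minWeight P)) := by ring
  rw [h6]
  nlinarith [sq_nonneg (‖trackErr (ref.ξ τ) (ξ τ)‖ - 2 * ‖trackErr (ref.ξ s) (ξ s)‖)]

/-- A tracking error cannot be removed without a running cost quadratic in it: either it persists,
or the input error that removes it is paid for. -/
lemma mul_norm_sq_le_runCost (h : IsArc P u ξ s e) (hP : P.Admissible)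
    (href : ref.Admissible P) (hs : P.t₀ ≤ s) (hse : s ≤ e) :
    minWeight P * (e - s) / (2 * (1 + (e - s) ^ 2)) * ‖trackErr (ref.ξ s) (ξ s)‖ ^ 2
      ≤ runCost P ref u ξ s e := by
  have h2 := h.minWeight_mul_integral_le hP href hs hse
  have hm := minWeight_pos hP
  have h3 : 0 ≤ ∫ σ in s..e, ‖trackErr (ref.ξ σ) (ξ σ)‖ ^ 2 :=
    intervalIntegral.integral_nonneg hse fun _ _ => by positivity
  have h4 : 0 ≤ ∫ σ in s..e, ‖inputErr P.ρ (ref.ξ σ) (ref.u σ) (ξ σ) (u σ)‖ ^ 2 :=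
    intervalIntegral.integral_nonneg hse fun _ _ => by positivity
  have hpt := fun τ (hτ : τ ∈ Icc s e) => h.abs_norm_sub_sq_le hP href hs hτ
  have hi := h.intervalIntegrable_norm_trackErr_sq hP href hs hse
  set W := ∫ σ in s..e, ‖inputErr P.ρ (ref.ξ σ) (ref.u σ) (ξ σ) (u σ)‖ ^ 2
  set I := ∫ σ in s..e, ‖trackErr (ref.ξ σ) (ξ σ)‖ ^ 2 with hI
  set m := ‖trackErr (ref.ξ s) (ξ s)‖
  have h5 : ∫ σ in s..e, (m ^ 2 - 2 * ((e - s) * W)) ≤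
      ∫ σ in s..e, 2 * ‖trackErr (ref.ξ σ) (ξ σ)‖ ^ 2 := by
    refine intervalIntegral.integral_mono_on hse (by simp) (hi.const_mul _) fun τ hτ => ?_
    nlinarith [hpt τ hτ, sq_nonneg (2 * ‖trackErr (ref.ξ τ) (ξ τ)‖ - m)]
  rw [intervalIntegral.integral_const, intervalIntegral.integral_const_mul, ← hI,
    smul_eq_mul] at h5
  have h6 : (e - s) * m ^ 2 ≤ 2 * (1 + (e - s) ^ 2) * (I + W) := by
    nlinarith [mul_nonneg (sq_nonneg (e - s)) h3]
  rw [div_mul_eq_mul_div, div_le_iff₀ (by positivity)]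
  calc minWeight P * (e - s) * m ^ 2 = minWeight P * ((e - s) * m ^ 2) := by ring
    _ ≤ minWeight P * (2 * (1 + (e - s) ^ 2) * (I + W)) := by gcongr
    _ = (minWeight P * (I + W)) * (2 * (1 + (e - s) ^ 2)) := by ring
    _ ≤ _ := by gcongr

end IsArc

/-- A disturbance of the head position does not affect the orientation, and in the inertial frame
it displaces the head by its integral only. -/
lemma IsArc.norm_posErr_sub_le_of_disturbed (h : IsArc P u ξ s e) (hP : P.Admissible)
    {d : ℝ → E2} {η : ℝ} (hd : IsDisturbance P η d) (hs : P.t₀ ≤ s) {x : ℝ → E3}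
    (hx : IsSolution (fun σ y => headField P.ρ y (u σ) + !₂[d σ 0, d σ 1, 0]) s e x)
    (hxs : x s = ξ s) {τ : ℝ} (hτ : τ ∈ Icc s e) :
    x τ 2 = ξ τ 2 ∧ ∀ ζr : E3, ‖posErr ζr (x τ) - posErr ζr (ξ τ)‖ ≤ η * (τ - s) := by
  have hH : Continuous fun z : E3 × (E2 × E2) =>
      headField P.ρ z.1 z.2.1 + !₂[z.2.2 0, z.2.2 1, 0] := by
    unfold headField
    fun_prop
  have hix : ∀ t ∈ Icc s e, IntervalIntegrable
      (fun σ => headField P.ρ (x σ) (u σ) + !₂[d σ 0, d σ 1, 0]) volume s t := fun t ht =>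
    intervalIntegrable_comp_of_bounded (C := max (P.a + P.b) η)
      (u := fun σ => (u σ, d σ)) hH ht.1 (hx.1.mono (Icc_subset_Icc_right ht.2))
      (h.measurable.prodMk hd.1)
      fun σ hσ => norm_prod_le_iff.2
        ⟨(h.norm_input_le hP ⟨hσ.1, hσ.2.trans ht.2⟩).trans (le_max_left _ _),
        (hd.2 σ (hs.trans hσ.1)).trans (le_max_right _ _)⟩
  have hin := fun t (ht : t ∈ Icc s e) => h.intervalIntegrable_field hP le_rfl ht.1 ht.2
  have hdi : IntervalIntegrable d volume s τ := by
    have := intervalIntegrable_comp_of_bounded (H := fun z : E3 × E2 => z.2) (C := η)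
      continuous_snd hτ.1 (hx.1.mono (Icc_subset_Icc_right hτ.2)) hd.1
      fun σ hσ => hd.2 σ (hs.trans hσ.1)
    exact this
  have key : ∀ t ∈ Icc s e, x t - ξ t = ∫ σ in s..t,
      (headField P.ρ (x σ) (u σ) + !₂[d σ 0, d σ 1, 0] - headField P.ρ (ξ σ) (u σ)) := by
    intro t ht
    rw [intervalIntegral.integral_sub (hix t ht) (hin t ht), hx.2 t ht, h.solution.2 t ht, hxs]
    abel
  have hθ : ∀ t ∈ Icc s e, x t 2 = ξ t 2 := by
    intro t ht
    have := congrArg (· 2) (key t ht)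
    simp only [integral_coord ((hix t ht).sub (hin t ht))] at this
    simp [headField] at this
    linarith
  refine ⟨hθ τ hτ, fun ζr => ?_⟩
  have h1 : posErr ζr (x τ) - posErr ζr (ξ τ) = -∫ σ in s..τ, d σ := by
    have hk := key τ hτ
    have hfun : EqOn (fun σ => headField P.ρ (x σ) (u σ) + !₂[d σ 0, d σ 1, 0]
        - headField P.ρ (ξ σ) (u σ)) (fun σ => !₂[d σ 0, d σ 1, 0]) (uIcc s τ) := by
      intro σ hσ
      rw [uIcc_of_le hτ.1] at hσ
      simp only [headField, hθ σ ⟨hσ.1, hσ.2.trans hτ.2⟩]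
      abel
    rw [intervalIntegral.integral_congr hfun] at hk
    have hd3 : IntervalIntegrable (fun σ => (!₂[d σ 0, d σ 1, 0] : E3)) volume s τ := by
      refine ((hix τ hτ).sub (hin τ hτ)).congr fun σ hσ => hfun ?_
      exact uIoc_subset_uIcc hσ
    ext i
    have e0 := congrArg (· 0) hk
    have e1 := congrArg (· 1) hk
    simp only [integral_coord hd3] at e0 e1
    rw [PiLp.neg_apply, integral_coord hdi]
    fin_cases i
    · simp [posErr] at e0 ⊢
      linarith
    · simp [posErr] at e1 ⊢
      linarith
  rw [h1, norm_neg, ← abs_of_nonneg (sub_nonneg.2 hτ.1)]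
  refine intervalIntegral.norm_integral_le_of_norm_le_const fun σ hσ => ?_
  rw [uIoc_of_le hτ.1] at hσ
  exact hd.2 σ (hs.trans hσ.1.le)

end

/-! ### The clipped terminal controller -/

section

/-- The interval of admissible gains is the one on which the stage cost of the terminal controller,
with weights `q + p k²`, is below the decrease of the terminal penalty. -/
lemma gain_bound {p q k : ℝ} (hp : 0 < p) (hpq : p * q < 1 / 4)
    (hk : k ∈ Ioo ((1 - √(1 - 4 * p * q)) / (2 * p)) ((1 + √(1 - 4 * p * q)) / (2 * p))) :
    q + p * k ^ 2 < k := by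
  obtain ⟨h1, h2⟩ := hk
  rw [div_lt_iff₀ (by positivity)] at h1
  rw [lt_div_iff₀ (by positivity)] at h2
  have hs : √(1 - 4 * p * q) ^ 2 = 1 - 4 * p * q := sq_sqrt (by nlinarith)
  have h3 : (2 * p * k - 1) ^ 2 < √(1 - 4 * p * q) ^ 2 := sq_lt_sq' (by linarith) (by linarith)
  rw [hs] at h3
  have h4 : 4 * p * (q + p * k ^ 2 - k) < 0 := by nlinarith
  have := neg_of_mul_neg_right h4 (by positivity)
  linarith

section Clip

/-- The nearest-point projection onto the disc of radius `R`. -/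
def clip (R : ℝ) (p : E2) : E2 := (R / max R ‖p‖) • p

variable {R : ℝ} {p q : E2}

lemma clip_of_le (hR : 0 < R) (h : ‖p‖ ≤ R) : clip R p = p := by
  rw [clip, max_eq_left h, div_self hR.ne', one_smul]

lemma norm_clip_le (hR : 0 < R) (p : E2) : ‖clip R p‖ ≤ R := by
  have hm : 0 < max R ‖p‖ := lt_max_of_lt_left hR
  rw [clip, norm_smul, Real.norm_of_nonneg (by positivity), div_mul_eq_mul_div,
    div_le_iff₀ hm]
  exact mul_le_mul_of_nonneg_left (le_max_right _ _) hR.le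

lemma norm_clip_sub_le (hR : 0 < R) (p q : E2) : ‖clip R p - clip R q‖ ≤ 2 * ‖p - q‖ := by
  have hm : 0 < max R ‖p‖ := lt_max_of_lt_left hR
  have hn : 0 < max R ‖q‖ := lt_max_of_lt_left hR
  set m := max R ‖p‖ with hm'
  set n := max R ‖q‖ with hn'
  have h1 : clip R p - clip R q = (R / m) • (p - q) + ((R / m) * ((n - m) / n)) • q := by
    have : (R / m) * ((n - m) / n) = R / m - R / n := by field_simp
    rw [this, sub_smul, smul_sub, clip, clip]
    abel
  have h2 : |n - m| ≤ ‖p - q‖ := by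
    have h := abs_max_sub_max_le_max R ‖q‖ R ‖p‖
    rw [sub_self, abs_zero, max_eq_right (abs_nonneg (‖q‖ - ‖p‖)), ← hm', ← hn'] at h
    rw [norm_sub_rev]
    exact h.trans (abs_norm_sub_norm_le _ _)
  have h3 : R / m ≤ 1 := (div_le_one hm).2 (le_max_left _ _)
  have h4 : 0 ≤ R / m := by positivity
  have h5 : ‖q‖ / n ≤ 1 := (div_le_one hn).2 (le_max_right _ _)
  have h6 : 0 ≤ ‖q‖ / n := by positivity
  calc ‖clip R p - clip R q‖
      ≤ ‖(R / m) • (p - q)‖ + ‖((R / m) * ((n - m) / n)) • q‖ := by rw [h1]; exact norm_add_le _ _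
    _ = (R / m) * ‖p - q‖ + (R / m) * (|n - m| * (‖q‖ / n)) := by
      rw [norm_smul, norm_smul, Real.norm_eq_abs, Real.norm_eq_abs, abs_mul, abs_div (n - m),
        abs_of_nonneg h4, abs_of_pos hn]
      ring
    _ ≤ 1 * ‖p - q‖ + 1 * (‖p - q‖ * 1) := by gcongr
    _ = 2 * ‖p - q‖ := by ring

lemma continuous_clip (hR : 0 < R) : Continuous (clip R) := by
  have : ∀ p : E2, max R ‖p‖ ≠ 0 := fun p => (lt_max_of_lt_left hR).ne'
  unfold clip
  fun_prop (disch := assumption)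

end Clip

lemma trackErr_apply_zero (ζr ζ : E3) : trackErr ζr ζ 0
    = cos (ζ 2) * posErr ζr ζ 0 + sin (ζ 2) * posErr ζr ζ 1 := rfl

lemma trackErr_apply_one (ζr ζ : E3) : trackErr ζr ζ 1
    = -sin (ζ 2) * posErr ζr ζ 0 + cos (ζ 2) * posErr ζr ζ 1 := rfl

/-- The terminal controller: the input for which the input error is `-(k₁ p₀, k₂ p₁)`, with the
tracking error `p` clipped to the disc of radius `R`. -/
def feedback (P : Params) (R : ℝ) (ζr : E3) (ur : E2) (ζ : E3) : E2 :=
  !₂[P.k₁ * clip R (trackErr ζr ζ) 0 + ur 0 * cos (ζr 2 - ζ 2),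
    (P.k₂ * clip R (trackErr ζr ζ) 1 + ur 0 * sin (ζr 2 - ζ 2)) / P.ρ]

lemma continuous_feedback (P : Params) {R : ℝ} (hR : 0 < R) :
    Continuous fun z : (E3 × E2) × E3 => feedback P R z.1.1 z.1.2 z.2 := by
  have h0 : Continuous fun z : (E3 × E2) × E3 => trackErr z.1.1 z.2 := by
    unfold trackErr
    fun_prop
  have h := (continuous_clip hR).comp h0
  have key : ∀ g : (E3 × E2) × E3 → E2, Continuous g → Continuous fun z : (E3 × E2) × E3 =>
      (!₂[P.k₁ * g z 0 + z.1.2 0 * cos (z.1.1 2 - z.2 2),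
        (P.k₂ * g z 1 + z.1.2 0 * sin (z.1.1 2 - z.2 2)) / P.ρ] : E2) := by
    intro g hg
    fun_prop
  exact key _ h

lemma inputErr_feedback {P : Params} (hρ : P.ρ ≠ 0) (R : ℝ) (ζr : E3) (ur : E2) (ζ : E3) :
    inputErr P.ρ ζr ur ζ (feedback P R ζr ur ζ)
      = !₂[-(P.k₁ * clip R (trackErr ζr ζ) 0), -(P.k₂ * clip R (trackErr ζr ζ) 1)] := by
  ext i
  fin_cases i
  · simp [inputErr, feedback]
  · simp [inputErr, feedback]
    field_simp
    ring

lemma inner_posErr_velErr (ρ : ℝ) (ζr : E3) (ur : E2) (ζ : E3) (u : E2) :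
    inner ℝ (posErr ζr ζ) (velErr ρ ζr ur ζ u)
      = inner ℝ (trackErr ζr ζ) (inputErr ρ ζr ur ζ u) := by
  simp [PiLp.inner_apply, Fin.sum_univ_two, posErr, velErr, trackErr, inputErr, cos_sub, sin_sub]
  linear_combination (-(ur 0 * cos (ζr 2) * (ζr 0 - ζ 0)) - ur 0 * sin (ζr 2) * (ζr 1 - ζ 1))
    * sin_sq_add_cos_sq (ζ 2)

lemma abs_speed_le_lambdaR {P : Params} {ref : Reference} (hP : P.Admissible)
    (href : ref.Admissible P) {t : ℝ} (ht : P.t₀ ≤ t) : √2 * |ref.u t 0| ≤ P.a * lambdaR P ref := by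
  have hb : BddAbove ((fun t => |ref.u t 0|) '' Ici P.t₀) := by
    refine ⟨P.a / √2, ?_⟩
    rintro _ ⟨τ, hτ, rfl⟩
    exact (href.speed τ hτ).le
  have h := le_csSup hb ⟨t, ht, rfl⟩
  have ha := hP.a_pos
  have e : P.a * lambdaR P ref = √2 * sSup ((fun t => |ref.u t 0|) '' Ici P.t₀) := by
    rw [lambdaR]
    field_simp
  rw [e]
  exact mul_le_mul_of_nonneg_left h (by positivity)

lemma abs_add_abs_le_sqrt_mul (x y k l : ℝ) :
    |k * x| + |l * y| ≤ √(k ^ 2 + l ^ 2) * √(x ^ 2 + y ^ 2) := by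
  rw [← sqrt_mul (by positivity)]
  refine le_sqrt_of_sq_le ?_
  rw [← sq_abs k, ← sq_abs l, ← sq_abs x, ← sq_abs y, abs_mul, abs_mul]
  nlinarith [sq_nonneg (|k| * |y| - |l| * |x|)]

/-- The radius is chosen such that the terminal controller respects the input constraint on the disc
of this radius. -/
lemma feedback_mem_U {P : Params} {ref : Reference} (hP : P.Admissible) (href : ref.Admissible P)
    (hr : 0 < radius P ref) {t : ℝ} (ht : P.t₀ ≤ t) (ζr ζ : E3) :
    feedback P (radius P ref) ζr (ref.u t) ζ ∈ P.U := by
  have hρ := hP.ρ_pos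
  rw [mem_U_iff hP.a_pos]
  set q := clip (radius P ref) (trackErr ζr ζ) with hq
  set v := ref.u t 0 with hv
  set φ := ζr 2 - ζ 2
  have e0 : feedback P (radius P ref) ζr (ref.u t) ζ 0 = P.k₁ * q 0 + v * cos φ := rfl
  have e1 : P.ρ * |feedback P (radius P ref) ζr (ref.u t) ζ 1| = |P.k₂ * q 1 + v * sin φ| := by
    have : feedback P (radius P ref) ζr (ref.u t) ζ 1 = (P.k₂ * q 1 + v * sin φ) / P.ρ := rfl
    rw [this, abs_div, abs_of_pos hρ]
    field_simp
  have hK : 0 < √(P.k₁ ^ 2 + P.k₂ ^ 2) := by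
    by_contra h0
    have : √(P.k₁ ^ 2 + P.k₂ ^ 2) = 0 := le_antisymm (not_lt.1 h0) (sqrt_nonneg _)
    rw [radius, this, div_zero] at hr
    exact lt_irrefl _ hr
  have hR : √(P.k₁ ^ 2 + P.k₂ ^ 2) * radius P ref = P.a * (1 - lambdaR P ref) := by
    rw [radius]
    field_simp
  have h1 := abs_add_abs_le_sqrt_mul (q 0) (q 1) P.k₁ P.k₂
  have h2 := abs_add_abs_le_sqrt_mul v v (cos φ) (sin φ)
  rw [← norm_sq_E2, sqrt_sq (norm_nonneg _)] at h1
  rw [cos_sq_add_sin_sq, sqrt_one, one_mul, ← two_mul, sqrt_mul zero_le_two, sqrt_sq_eq_abs] at h2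
  have h3 : √(P.k₁ ^ 2 + P.k₂ ^ 2) * ‖q‖ ≤ P.a * (1 - lambdaR P ref) := by
    rw [← hR]
    exact mul_le_mul_of_nonneg_left (norm_clip_le hr _) hK.le
  have h4 := abs_speed_le_lambdaR hP href ht
  rw [← hv] at h4
  rw [e0, e1]
  have h5 := abs_add_le (P.k₁ * q 0) (v * cos φ)
  have h6 := abs_add_le (P.k₂ * q 1) (v * sin φ)
  rw [mul_comm (cos φ), mul_comm (sin φ)] at h2
  linarith

section BddLip

/-- The real functions `f t` of a state, for the times `t` in `S`, are bounded and Lipschitz,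
uniformly in `t`. -/
def BddLip (S : Set ℝ) (f : ℝ → E3 → ℝ) : Prop :=
  ∃ C, 0 ≤ C ∧ ∀ t ∈ S, (∀ x, |f t x| ≤ C) ∧ ∀ x y, |f t x - f t y| ≤ C * ‖x - y‖

variable {S : Set ℝ} {f g : ℝ → E3 → ℝ}

lemma BddLip.of_le {A B : ℝ} (h1 : ∀ t ∈ S, ∀ x, |f t x| ≤ A)
    (h2 : ∀ t ∈ S, ∀ x y, |f t x - f t y| ≤ B * ‖x - y‖) : BddLip S f :=
  ⟨max 0 (max A B), le_max_left _ _, fun t ht =>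
    ⟨fun x => (h1 t ht x).trans ((le_max_left _ _).trans (le_max_right _ _)),
    fun x y => (h2 t ht x y).trans (mul_le_mul_of_nonneg_right
      ((le_max_right _ _).trans (le_max_right _ _)) (norm_nonneg _))⟩⟩

lemma BddLip.add (hf : BddLip S f) (hg : BddLip S g) : BddLip S fun t x => f t x + g t x := by
  obtain ⟨A, hA, h1⟩ := hf
  obtain ⟨B, hB, h2⟩ := hg
  refine .of_le (A := A + B) (B := A + B) (fun t ht x => ?_) fun t ht x y => ?_
  · exact (abs_add_le _ _).trans (add_le_add ((h1 t ht).1 x) ((h2 t ht).1 x))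
  · rw [add_sub_add_comm, add_mul]
    exact (abs_add_le _ _).trans (add_le_add ((h1 t ht).2 x y) ((h2 t ht).2 x y))

lemma BddLip.mul (hf : BddLip S f) (hg : BddLip S g) : BddLip S fun t x => f t x * g t x := by
  obtain ⟨A, hA, h1⟩ := hf
  obtain ⟨B, hB, h2⟩ := hg
  refine .of_le (A := A * B) (B := 2 * A * B) (fun t ht x => ?_) fun t ht x y => ?_
  · rw [abs_mul]
    exact mul_le_mul ((h1 t ht).1 x) ((h2 t ht).1 x) (abs_nonneg _) hA
  · have e : f t x * g t x - f t y * g t y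
        = f t x * (g t x - g t y) + (f t x - f t y) * g t y := by ring
    rw [e]
    refine (abs_add_le _ _).trans ?_
    rw [abs_mul, abs_mul]
    calc _ ≤ A * (B * ‖x - y‖) + (A * ‖x - y‖) * B := by
          gcongr
          · exact (h1 t ht).1 x
          · exact (h2 t ht).2 x y
          · exact (h1 t ht).2 x y
          · exact (h2 t ht).1 y
      _ = _ := by ring

lemma BddLip.of_bounded {c : ℝ → ℝ} {C : ℝ} (h : ∀ t ∈ S, |c t| ≤ C) :
    BddLip S fun t _ => c t :=
  .of_le (A := C) (B := 0) (fun t ht _ => h t ht) fun t _ x y => by simp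

lemma BddLip.const (c : ℝ) : BddLip S fun _ _ => c := .of_bounded (C := |c|) fun _ _ => le_rfl

lemma BddLip.sin_sub (c : ℝ → ℝ) : BddLip S fun t x => sin (c t - x 2) := by
  refine .of_le (A := 1) (B := 1) (fun t _ x => abs_sin_le_one _) fun t _ x y => ?_
  refine (abs_sin_sub_sin_le _ _).trans ?_
  rw [one_mul, sub_sub_sub_cancel_left, abs_sub_comm]
  exact abs_coord_le_norm (x - y) 2

lemma BddLip.cos_sub (c : ℝ → ℝ) : BddLip S fun t x => cos (c t - x 2) := by
  refine .of_le (A := 1) (B := 1) (fun t _ x => abs_cos_le_one _) fun t _ x y => ?_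
  refine (abs_cos_sub_cos_le _ _).trans ?_
  rw [one_mul, sub_sub_sub_cancel_left, abs_sub_comm]
  exact abs_coord_le_norm (x - y) 2

lemma BddLip.sin : BddLip S fun _ x => Real.sin (x 2) := by
  simpa using (BddLip.const (-1)).mul (BddLip.sin_sub (S := S) fun _ => 0)

lemma BddLip.cos : BddLip S fun _ x => Real.cos (x 2) := by
  simpa using BddLip.cos_sub (S := S) fun _ => 0

lemma BddLip.clip_posErr {R : ℝ} (hR : 0 < R) (c : ℝ → E3) (i : Fin 2) :
    BddLip S fun t x => clip R (posErr (c t) x) i := by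
  refine .of_le (A := R) (B := 4) (fun t _ x => ?_) fun t _ x y => ?_
  · exact (abs_coord_le_norm _ i).trans (norm_clip_le hR _)
  · have h1 := (abs_coord_le_norm (clip R (posErr (c t) x) - clip R (posErr (c t) y)) i).trans
      (norm_clip_sub_le hR _ _)
    have h2 : ‖posErr (c t) x - posErr (c t) y‖ ≤ 2 * ‖x - y‖ := by
      refine (norm_E2_le _).trans ?_
      have e0 := abs_coord_le_norm (x - y) 0
      have e1 := abs_coord_le_norm (x - y) 1
      simp [posErr] at e0 e1 ⊢
      rw [abs_sub_comm (y 0), abs_sub_comm (y 1)]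
      linarith
    exact h1.trans (by linarith)

end BddLip

/-- The closed loop of the head kinematics with the clipped terminal controller. -/
def closedLoop (P : Params) (R : ℝ) (ζr : E3) (ur : E2) (ζ : E3) : E3 :=
  headField P.ρ ζ (feedback P R ζr ur ζ)

lemma clip_trackErr (R : ℝ) (ζr ζ : E3) :
    clip R (trackErr ζr ζ) 0 = cos (ζ 2) * clip R (posErr ζr ζ) 0
      + sin (ζ 2) * clip R (posErr ζr ζ) 1 ∧
    clip R (trackErr ζr ζ) 1 = (-1) * (sin (ζ 2) * clip R (posErr ζr ζ) 0)
      + cos (ζ 2) * clip R (posErr ζr ζ) 1 := by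
  simp only [clip, norm_trackErr, PiLp.smul_apply, smul_eq_mul, trackErr_apply_zero,
    trackErr_apply_one]
  constructor <;> ring

/-- Clipping makes the closed loop bounded and Lipschitz in the state, uniformly in time. -/
lemma exists_bound_closedLoop {P : Params} {R : ℝ} (hR : 0 < R) (S : Set ℝ) (c : ℝ → E3)
    {w : ℝ → E2} {C : ℝ} (hw : ∀ t ∈ S, ‖w t‖ ≤ C) :
    ∃ K, 0 ≤ K ∧ ∀ t ∈ S, (∀ x, ‖closedLoop P R (c t) (w t) x‖ ≤ K) ∧
      ∀ x y, ‖closedLoop P R (c t) (w t) x - closedLoop P R (c t) (w t) y‖ ≤ K * ‖x - y‖ := by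
  have hv : BddLip S fun t _ => w t 0 :=
    .of_bounded fun t ht => (abs_coord_le_norm (w t) 0).trans (hw t ht)
  have hc0 : BddLip S fun t x => clip R (posErr (c t) x) 0 := .clip_posErr hR c 0
  have hc1 : BddLip S fun t x => clip R (posErr (c t) x) 1 := .clip_posErr hR c 1
  have hp0 : BddLip S fun t x => clip R (trackErr (c t) x) 0 := by
    simp only [(clip_trackErr R _ _).1]
    exact (BddLip.cos.mul hc0).add (BddLip.sin.mul hc1)
  have hp1 : BddLip S fun t x => clip R (trackErr (c t) x) 1 := by
    simp only [(clip_trackErr R _ _).2]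
    exact ((BddLip.const (-1)).mul (BddLip.sin.mul hc0)).add (BddLip.cos.mul hc1)
  have hu0 : BddLip S fun t x => feedback P R (c t) (w t) x 0 :=
    ((BddLip.const P.k₁).mul hp0).add (hv.mul (BddLip.cos_sub fun t => c t 2))
  have hu1 : BddLip S fun t x => feedback P R (c t) (w t) x 1 := by
    have := (((BddLip.const P.k₂).mul hp1).add (hv.mul (BddLip.sin_sub fun t => c t 2))).mul
      (BddLip.const P.ρ⁻¹)
    exact this
  have hF0 : BddLip S fun t x => closedLoop P R (c t) (w t) x 0 := by
    have := (hu0.mul BddLip.cos).add ((BddLip.const (-P.ρ)).mul (hu1.mul BddLip.sin))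
    convert this using 3
    simp [closedLoop, headField]
    ring
  have hF1 : BddLip S fun t x => closedLoop P R (c t) (w t) x 1 := by
    have := (hu0.mul BddLip.sin).add ((BddLip.const P.ρ).mul (hu1.mul BddLip.cos))
    convert this using 3
    simp [closedLoop, headField]
    ring
  have hF2 : BddLip S fun t x => closedLoop P R (c t) (w t) x 2 := hu1
  obtain ⟨A, hA, h0⟩ := hF0
  obtain ⟨B, hB, h1⟩ := hF1
  obtain ⟨D, hD, h2⟩ := hF2
  refine ⟨A + B + D, by positivity, fun t ht => ⟨fun x => ?_, fun x y => ?_⟩⟩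
  · have := norm_E3_le (closedLoop P R (c t) (w t) x)
    linarith [(h0 t ht).1 x, (h1 t ht).1 x, (h2 t ht).1 x]
  · have := norm_E3_le (closedLoop P R (c t) (w t) x - closedLoop P R (c t) (w t) y)
    simp only [PiLp.sub_apply] at this
    linarith [(h0 t ht).2 x y, (h1 t ht).2 x y, (h2 t ht).2 x y]

end

/-! ### Trajectories of the terminal controller -/

section

variable {P : Params} {ref : Reference} {s e : ℝ}

/-- The reference is continued to the left of `t₀` by a constant, to be continuous on the line. -/
lemma Reference.Admissible.continuous_extend (href : ref.Admissible P) :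
    Continuous fun t => ref.ξ (max P.t₀ t) :=
  href.continuousOn.comp_continuous (by fun_prop) fun t => le_max_left P.t₀ t

lemma exists_closedLoop_arc (hP : P.Admissible) (href : ref.Admissible P) (hr : 0 < radius P ref)
    (hs : P.t₀ ≤ s) (hse : s ≤ e) (ζ : E3) :
    ∃ (u : ℝ → E2) (x : ℝ → E3), IsArc P u x s e ∧ Continuous x ∧ x s = ζ ∧
      ∀ τ, P.t₀ ≤ τ → u τ = feedback P (radius P ref) (ref.ξ τ) (ref.u τ) (x τ) := by
  set R := radius P ref with hR
  set c : ℝ → E3 := fun t => ref.ξ (max P.t₀ t) with hc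
  have hcc : Continuous c := href.continuous_extend
  have hcτ : ∀ τ, P.t₀ ≤ τ → c τ = ref.ξ τ := fun τ hτ => by simp [hc, max_eq_right hτ]
  obtain ⟨K, hK, hF⟩ := exists_bound_closedLoop (P := P) hr (Icc s e) c (w := ref.u)
    (C := P.a + P.b) fun t ht => href.norm_u_le hP (hs.trans ht.1)
  have hum : ∀ x : ℝ → E3, Continuous x →
      Measurable fun σ => feedback P R (c σ) (ref.u σ) (x σ) := by
    intro x hx
    have h := (continuous_feedback P hr).measurable.comp
      ((hcc.measurable.prodMk href.measurable).prodMk hx.measurable)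
    exact h
  have hmeas : ∀ x : ℝ → E3, Continuous x →
      StronglyMeasurable fun σ => closedLoop P R (c σ) (ref.u σ) (x σ) := by
    intro x hx
    have h := (continuous_headField P.ρ).measurable.comp (hx.measurable.prodMk (hum x hx))
    exact h.stronglyMeasurable
  obtain ⟨x, hx, hsol⟩ := exists_integral_curve_of_lipschitz hse hK hmeas
    (fun σ hσ => (hF σ hσ).1) (fun σ hσ => (hF σ hσ).2) ζ
  have hxs : x s = ζ := by simpa using hsol s ⟨le_rfl, hse⟩
  obtain ⟨u, hu⟩ : ∃ u : ℝ → E2, ∀ σ, u σ = feedback P R (c σ) (ref.u σ) (x σ) := ⟨_, fun _ => rfl⟩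
  have h1 : Measurable u := by
    rw [funext hu]
    exact hum x hx
  have h2 : IsSolution (fun σ y => headField P.ρ y (u σ)) s e x := by
    refine ⟨hx.continuousOn, ?_⟩
    simp only [hu, hxs]
    exact hsol
  have h3 : ∀ τ ∈ Icc s e, u τ ∈ P.U := by
    intro τ hτ
    rw [hu]
    exact feedback_mem_U hP href hr (hs.trans hτ.1) _ _
  have h4 : ∀ τ, P.t₀ ≤ τ → u τ = feedback P R (ref.ξ τ) (ref.u τ) (x τ) := by
    intro τ hτ
    rw [hu, hcτ τ hτ]
  exact ⟨u, x, ⟨h1, h2, h3⟩, hx, hxs, h4⟩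

/-- From every state with tracking error in the disc of radius `r`, the terminal controller is
admissible, its tracking error decays at the rate `min k₁ k₂`, and its running cost is paid for by
the decrease of the terminal penalty. -/
theorem exists_terminal_arc (hP : P.Admissible) (href : ref.Admissible P) (hr : 0 < radius P ref)
    (hs : P.t₀ ≤ s) (hse : s ≤ e) {ζ : E3} (hζ : ‖trackErr (ref.ξ s) ζ‖ ≤ radius P ref) :
    ∃ (u : ℝ → E2) (x : ℝ → E3), IsArc P u x s e ∧ x s = ζ ∧
      (∀ τ ∈ Icc s e, ‖trackErr (ref.ξ τ) (x τ)‖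
        ≤ exp (-(min P.k₁ P.k₂ * (τ - s))) * ‖trackErr (ref.ξ s) ζ‖) ∧
      runCost P ref u x s e + terminalCost (trackErr (ref.ξ e) (x e))
        ≤ terminalCost (trackErr (ref.ξ s) ζ) := by
  obtain ⟨u, x, harc, hx, hxs, hu⟩ := exists_closedLoop_arc hP href hr hs hse ζ
  refine ⟨u, x, harc, hxs, ?_⟩
  have hk₁ := gain_bound hP.p₁_pos hP.pq₁ hP.k₁_mem
  have hk₂ := gain_bound hP.p₂_pos hP.pq₂ hP.k₂_mem
  have hk₁0 : 0 < P.k₁ := by nlinarith [hP.q₁_pos, mul_nonneg hP.p₁_pos.le (sq_nonneg P.k₁)]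
  have hk₂0 : 0 < P.k₂ := by nlinarith [hP.q₂_pos, mul_nonneg hP.p₂_pos.le (sq_nonneg P.k₂)]
  set R := radius P ref
  set k := min P.k₁ P.k₂ with hk
  have hk0 : 0 < k := lt_min hk₁0 hk₂0
  set c : ℝ → E3 := fun t => ref.ξ (max P.t₀ t) with hc
  have hcc : Continuous c := href.continuous_extend
  have hcτ : ∀ τ, P.t₀ ≤ τ → c τ = ref.ξ τ := fun τ hτ => by simp [hc, max_eq_right hτ]
  have hst : ∀ τ ∈ Icc s e, P.t₀ ≤ τ := fun τ hτ => hs.trans hτ.1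
  set p : ℝ → E2 := fun τ => trackErr (c τ) (x τ) with hp
  -- The reference speed cancels in the velocity of the inertial error, which is thus continuous.
  set V : ℝ → E2 := fun τ => velErr P.ρ (c τ) 0 (x τ) (feedback P R (c τ) 0 (x τ)) with hV
  have hVc : Continuous V := by
    have h1 := (continuous_feedback P hr).comp
      ((hcc.prodMk (continuous_const (y := (0 : E2)))).prodMk hx)
    have h2 := (continuous_velErr P.ρ).comp
      ((hcc.prodMk hx).prodMk ((continuous_const (y := (0 : E2))).prodMk h1))
    exact h2
  have hVeq : ∀ τ ∈ Icc s e, velErr P.ρ (ref.ξ τ) (ref.u τ) (x τ) (u τ) = V τ := by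
    intro τ hτ
    rw [hu τ (hst τ hτ), hV, ← hcτ τ (hst τ hτ)]
    have hρ := hP.ρ_pos.ne'
    ext i
    fin_cases i
    · simp [velErr, feedback, cos_sub, sin_sub]
      field_simp
      linear_combination (-(ref.u τ 0) * cos (c τ 2)) * sin_sq_add_cos_sq (x τ 2)
    · simp [velErr, feedback, cos_sub, sin_sub]
      field_simp
      linear_combination (-(ref.u τ 0) * sin (c τ 2)) * sin_sq_add_cos_sq (x τ 2)
  set y : ℝ → E2 := fun τ => posErr (ref.ξ s) ζ + ∫ σ in s..τ, V σ with hy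
  have hyeq : ∀ τ ∈ Icc s e, y τ = posErr (c τ) (x τ) := by
    intro τ hτ
    have h1 := (harc.mono hP le_rfl hτ.2).posErr_sub_eq hP href hs hτ.1
    rw [hxs, intervalIntegral.integral_congr (g := V)] at h1
    · simp only [hy, ← h1, hcτ τ (hst τ hτ)]
      abel
    · intro σ hσ
      rw [uIcc_of_le hτ.1] at hσ
      exact hVeq σ ⟨hσ.1, hσ.2.trans hτ.2⟩
  have hyd : ∀ τ, HasDerivAt y (V τ) τ := fun τ =>
    (hVc.integral_hasStrictDerivAt s τ).hasDerivAt.const_add _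
  have hnd : ∀ τ, HasDerivAt (fun τ => ‖y τ‖ ^ 2) (2 * inner ℝ (y τ) (V τ)) τ := fun τ =>
    (hyd τ).norm_sq
  have hny : ∀ τ ∈ Icc s e, ‖y τ‖ = ‖p τ‖ := fun τ hτ => by
    rw [hyeq τ hτ, hp, norm_trackErr]
  have hinner : ∀ τ ∈ Icc s e, inner ℝ (y τ) (V τ)
      = -(R / max R ‖p τ‖ * (P.k₁ * p τ 0 ^ 2 + P.k₂ * p τ 1 ^ 2)) := by
    intro τ hτ
    rw [hyeq τ hτ, hV, inner_posErr_velErr, inputErr_feedback hP.ρ_pos.ne']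
    simp [PiLp.inner_apply, Fin.sum_univ_two, clip, hp]
    ring
  have hquad : ∀ τ, k * ‖p τ‖ ^ 2 ≤ P.k₁ * p τ 0 ^ 2 + P.k₂ * p τ 1 ^ 2 := by
    intro τ
    rw [norm_sq_E2]
    nlinarith [mul_le_mul_of_nonneg_right (min_le_left P.k₁ P.k₂) (sq_nonneg (p τ 0)),
      mul_le_mul_of_nonneg_right (min_le_right P.k₁ P.k₂) (sq_nonneg (p τ 1))]
  have hquad0 : ∀ τ, 0 ≤ P.k₁ * p τ 0 ^ 2 + P.k₂ * p τ 1 ^ 2 := fun τ => by positivity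
  have hyc : Continuous y := continuous_iff_continuousAt.2 fun τ => (hyd τ).continuousAt
  have hys : ‖y s‖ = ‖trackErr (ref.ξ s) ζ‖ := by simp [hy, norm_trackErr]
  -- Clipping only shortens the error, so the error does not grow, and hence is never clipped.
  have hanti : AntitoneOn (fun τ => ‖y τ‖ ^ 2) (Icc s e) := by
    refine antitoneOn_of_deriv_nonpos (convex_Icc s e) (by fun_prop)
      (fun τ _ => (hnd τ).differentiableAt.differentiableWithinAt) fun τ hτ => ?_
    rw [interior_Icc] at hτ
    rw [(hnd τ).deriv, hinner τ ⟨hτ.1.le, hτ.2.le⟩]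
    have : 0 < max R ‖p τ‖ := lt_max_of_lt_left hr
    have := mul_nonneg (div_nonneg hr.le this.le) (hquad0 τ)
    linarith
  have hpR : ∀ τ ∈ Icc s e, ‖p τ‖ ≤ R := by
    intro τ hτ
    have h1 := hanti ⟨le_rfl, hse⟩ hτ hτ.1
    rw [← hny τ hτ]
    exact (pow_le_pow_iff_left₀ (norm_nonneg _) (norm_nonneg _) two_ne_zero).1 h1
      |>.trans (hys.trans_le hζ)
  have hinner' : ∀ τ ∈ Icc s e, inner ℝ (y τ) (V τ)
      = -(P.k₁ * p τ 0 ^ 2 + P.k₂ * p τ 1 ^ 2) := by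
    intro τ hτ
    rw [hinner τ hτ, max_eq_left (hpR τ hτ), div_self hr.ne', one_mul]
  constructor
  · have hexp : ∀ τ, HasDerivAt (fun τ => exp (2 * k * (τ - s)) * ‖y τ‖ ^ 2)
        (exp (2 * k * (τ - s)) * (2 * k) * ‖y τ‖ ^ 2
          + exp (2 * k * (τ - s)) * (2 * inner ℝ (y τ) (V τ))) τ := by
      intro τ
      have h1 := (((hasDerivAt_id τ).sub_const s).const_mul (2 * k)).exp
      simp only [id, mul_one] at h1
      exact h1.mul (hnd τ)
    have hanti2 : AntitoneOn (fun τ => exp (2 * k * (τ - s)) * ‖y τ‖ ^ 2) (Icc s e) := by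
      refine antitoneOn_of_deriv_nonpos (convex_Icc s e) (by fun_prop)
        (fun τ _ => (hexp τ).differentiableAt.differentiableWithinAt) fun τ hτ => ?_
      rw [interior_Icc] at hτ
      have hτ' : τ ∈ Icc s e := ⟨hτ.1.le, hτ.2.le⟩
      rw [(hexp τ).deriv, hinner' τ hτ', hny τ hτ']
      have := mul_le_mul_of_nonneg_left (hquad τ) (exp_pos (2 * k * (τ - s))).le
      linarith
    intro τ hτ
    have h1 := hanti2 ⟨le_rfl, hse⟩ hτ hτ.1
    simp only [sub_self, mul_zero, exp_zero, one_mul] at h1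
    rw [hny τ hτ, hys] at h1
    have hpτ : trackErr (ref.ξ τ) (x τ) = p τ := by rw [hp, ← hcτ τ (hst τ hτ)]
    rw [hpτ]
    refine (pow_le_pow_iff_left₀ (norm_nonneg _) (by positivity) two_ne_zero).1 ?_
    rw [mul_pow, ← exp_nat_mul]
    have h2 : exp (2 * k * (τ - s)) * exp (((2 : ℕ) : ℝ) * -(k * (τ - s))) = 1 := by
      rw [← exp_add, ← exp_zero]
      congr 1
      push_cast
      ring
    calc ‖p τ‖ ^ 2 = exp (((2 : ℕ) : ℝ) * -(k * (τ - s)))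
          * (exp (2 * k * (τ - s)) * ‖p τ‖ ^ 2) := by linear_combination (-‖p τ‖ ^ 2) * h2
      _ ≤ _ := by gcongr
  · have hcost : runCost P ref u x s e ≤ ∫ τ in s..e, -(1 / 2) * (2 * inner ℝ (y τ) (V τ)) := by
      refine intervalIntegral.integral_mono_on hse
        (harc.intervalIntegrable_stageCost hP href hs hse)
        (Continuous.intervalIntegrable (by fun_prop) _ _) fun τ hτ => ?_
      rw [hinner' τ hτ, hu τ (hst τ hτ), inputErr_feedback hP.ρ_pos.ne', ← hcτ τ (hst τ hτ)]
      change stageCost P (p τ) !₂[-(P.k₁ * clip R (p τ) 0), -(P.k₂ * clip R (p τ) 1)] ≤ _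
      rw [clip_of_le hr (hpR τ hτ)]
      simp [stageCost]
      nlinarith [mul_le_mul_of_nonneg_right hk₁.le (sq_nonneg (p τ 0)),
        mul_le_mul_of_nonneg_right hk₂.le (sq_nonneg (p τ 1))]
    rw [intervalIntegral.integral_const_mul,
      intervalIntegral.integral_eq_sub_of_hasDerivAt (fun τ _ => hnd τ)
      (Continuous.intervalIntegrable (by fun_prop) _ _)] at hcost
    rw [hys, hny e ⟨hse, le_rfl⟩] at hcost
    simp only [hp, hcτ e (hs.trans hse)] at hcost
    simp only [terminalCost]
    linarith

end

/-! ### Feasible candidates and their costs -/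

section

variable {P : Params} {ref : Reference}

/-- The function `f` up to time `m`, followed by `g`. -/
def glue {α : Type*} (f g : ℝ → α) (m : ℝ) : ℝ → α := fun τ => if τ ≤ m then f τ else g τ

lemma glue_of_le {α : Type*} {f g : ℝ → α} {m τ : ℝ} (h : τ ≤ m) : glue f g m τ = f τ := if_pos h

lemma glue_of_lt {α : Type*} {f g : ℝ → α} {m τ : ℝ} (h : m < τ) : glue f g m τ = g τ :=
  if_neg h.not_ge

lemma glue_of_ge {α : Type*} {f g : ℝ → α} {m τ : ℝ} (hm : f m = g m) (h : m ≤ τ) :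
    glue f g m τ = g τ := by
  rcases h.eq_or_lt with rfl | h
  · rw [glue_of_le le_rfl, hm]
  · exact glue_of_lt h

lemma IsArc.glue {u u' : ℝ → E2} {ξ ξ' : ℝ → E3} {s m e : ℝ} (h : IsArc P u ξ s m)
    (h' : IsArc P u' ξ' m e) (hP : P.Admissible) (hsm : s ≤ m) (hme : m ≤ e) (hm : ξ m = ξ' m) :
    IsArc P (glue u u' m) (glue ξ ξ' m) s e := by
  have hmeas : Measurable (NRMPC.glue u u' m) :=
    Measurable.ite measurableSet_Iic h.measurable h'.measurable
  have hinput : ∀ τ ∈ Icc s e, NRMPC.glue u u' m τ ∈ P.U := by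
    intro τ hτ
    rcases le_or_gt τ m with hle | hlt
    · rw [glue_of_le hle]
      exact h.input τ ⟨hτ.1, hle⟩
    · rw [glue_of_lt hlt]
      exact h'.input τ ⟨hlt.le, hτ.2⟩
  have hcont : ContinuousOn (NRMPC.glue ξ ξ' m) (Icc s e) := by
    rw [← Icc_union_Icc_eq_Icc hsm hme]
    refine ContinuousOn.union_of_isClosed ?_ ?_ isClosed_Icc isClosed_Icc
    · exact h.solution.1.congr fun τ hτ => glue_of_le hτ.2
    · exact h'.solution.1.congr fun τ hτ => glue_of_ge hm hτ.1
  refine ⟨hmeas, ⟨hcont, fun τ hτ => ?_⟩, hinput⟩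
  have hint : ∀ a b, s ≤ a → a ≤ b → b ≤ e → IntervalIntegrable
      (fun σ => headField P.ρ (NRMPC.glue ξ ξ' m σ) (NRMPC.glue u u' m σ)) volume a b :=
    fun a b ha hab hb => intervalIntegrable_comp_of_bounded (continuous_headField P.ρ) hab
      (hcont.mono (Icc_subset_Icc ha hb)) hmeas fun σ hσ =>
      norm_le_of_mem_U hP.a_pos hP.ρ_pos (hinput σ ⟨ha.trans hσ.1, hσ.2.trans hb⟩)
  have hleft : ∀ b ∈ Icc s m,
      ∫ σ in s..b, headField P.ρ (NRMPC.glue ξ ξ' m σ) (NRMPC.glue u u' m σ) = ξ b - ξ s := by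
    intro b hb
    rw [h.sub_eq hP le_rfl hb.1 hb.2]
    refine intervalIntegral.integral_congr fun σ hσ => ?_
    rw [uIcc_of_le hb.1] at hσ
    simp only [glue_of_le (hσ.2.trans hb.2)]
  rw [glue_of_le hsm]
  rcases le_or_gt τ m with hle | hlt
  · rw [glue_of_le hle, hleft τ ⟨hτ.1, hle⟩]
    abel
  · have hright : ∫ σ in m..τ, headField P.ρ (NRMPC.glue ξ ξ' m σ) (NRMPC.glue u u' m σ)
        = ξ' τ - ξ' m := by
      rw [h'.sub_eq hP le_rfl hlt.le hτ.2]
      refine intervalIntegral.integral_congr_ae (Eventually.of_forall fun σ hσ => ?_)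
      rw [uIoc_of_le hlt.le] at hσ
      rw [glue_of_lt hσ.1, glue_of_lt hσ.1]
    rw [glue_of_lt hlt, ← intervalIntegral.integral_add_adjacent_intervals
      (hint s m le_rfl hsm hme) (hint m τ hsm hlt.le hτ.2), hleft m ⟨hsm, le_rfl⟩, hright, hm]
    abel

lemma IsArc.runCost_add {u : ℝ → E2} {ξ : ℝ → E3} {s m e : ℝ} (h : IsArc P u ξ s e)
    (hP : P.Admissible) (href : ref.Admissible P) (hs : P.t₀ ≤ s) (hsm : s ≤ m) (hme : m ≤ e) :
    runCost P ref u ξ s e = runCost P ref u ξ s m + runCost P ref u ξ m e :=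
  (intervalIntegral.integral_add_adjacent_intervals
    ((h.mono hP le_rfl hme).intervalIntegrable_stageCost hP href hs hsm)
    ((h.mono hP hsm le_rfl).intervalIntegrable_stageCost hP href (hs.trans hsm) hme)).symm

lemma runCost_glue_left {u u' : ℝ → E2} {ξ ξ' : ℝ → E3} {s m : ℝ} (hsm : s ≤ m) :
    runCost P ref (glue u u' m) (glue ξ ξ' m) s m = runCost P ref u ξ s m := by
  refine intervalIntegral.integral_congr fun σ hσ => ?_
  rw [uIcc_of_le hsm] at hσ
  simp only [glue_of_le hσ.2]

lemma runCost_glue_right {u u' : ℝ → E2} {ξ ξ' : ℝ → E3} {m e : ℝ} (hme : m ≤ e) :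
    runCost P ref (glue u u' m) (glue ξ ξ' m) m e = runCost P ref u' ξ' m e := by
  refine intervalIntegral.integral_congr_ae (Eventually.of_forall fun σ hσ => ?_)
  rw [uIoc_of_le hme] at hσ
  simp only [glue_of_lt hσ.1]

/-- The head kinematics are invariant under translations of the position. -/
lemma IsArc.add_const {u : ℝ → E2} {ξ : ℝ → E3} {s e : ℝ} (h : IsArc P u ξ s e) {c : E3}
    (hc : c 2 = 0) : IsArc P u (fun τ => ξ τ + c) s e where
  measurable := h.measurable
  solution := by
    refine ⟨h.solution.1.add continuousOn_const, fun τ hτ => ?_⟩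
    have h1 : ∀ σ, headField P.ρ (ξ σ + c) (u σ) = headField P.ρ (ξ σ) (u σ) := fun σ => by
      simp [headField, hc]
    simp only [h1]
    rw [h.solution.2 τ hτ]
    abel
  input := h.input

lemma norm_trackErr_sub {ζr ζ ζ' : E3} (h : ζ' 2 = ζ 2) :
    ‖trackErr ζr ζ' - trackErr ζr ζ‖ = ‖posErr ζr ζ' - posErr ζr ζ‖ := by
  rw [← sq_eq_sq₀ (norm_nonneg _) (norm_nonneg _), norm_sq_E2, norm_sq_E2]
  simp [trackErr, posErr, h]
  linear_combination ((ζ' 0 - ζ 0) ^ 2 + (ζ' 1 - ζ 1) ^ 2) * sin_sq_add_cos_sq (ζ 2)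

lemma inputErr_congr {ρ : ℝ} {ζr ζ ζ' : E3} {ur u : E2} (h : ζ' 2 = ζ 2) :
    inputErr ρ ζr ur ζ' u = inputErr ρ ζr ur ζ u := by
  simp only [inputErr, h]

lemma stageCost_le_add (hP : P.Admissible) {p p' : E2} (w : E2) {D B : ℝ} (hD : ‖p' - p‖ ≤ D)
    (hp : ‖p‖ ≤ B) :
    stageCost P p' w ≤ stageCost P p w + (P.q₁ + P.q₂) * (2 * B * D + D ^ 2) := by
  have hi : ∀ i, p' i ^ 2 ≤ p i ^ 2 + (2 * B * D + D ^ 2) := by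
    intro i
    have h1 : |p' i - p i| ≤ D := (abs_coord_le_norm (p' - p) i).trans hD
    have h2 : |p i| ≤ B := (abs_coord_le_norm p i).trans hp
    have h3 : |p i| * |p' i - p i| ≤ B * D :=
      mul_le_mul h2 h1 (abs_nonneg _) ((abs_nonneg _).trans h2)
    rw [← abs_mul] at h3
    have h4 := (le_abs_self _).trans h3
    have h5 : (p' i - p i) ^ 2 ≤ D ^ 2 := sq_le_sq' (abs_le.1 h1).1 (abs_le.1 h1).2
    nlinarith
  rw [stageCost, stageCost]
  nlinarith [mul_le_mul_of_nonneg_left (hi 0) hP.q₁_pos.le,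
    mul_le_mul_of_nonneg_left (hi 1) hP.q₂_pos.le]

lemma Params.Admissible.δ_le_T (hP : P.Admissible) : P.δ ≤ P.T := by
  have : (1 : ℝ) ≤ P.N := by exact_mod_cast hP.N_pos
  rw [Params.T]
  nlinarith [hP.δ_pos]

lemma Params.Admissible.T_pos (hP : P.Admissible) : 0 < P.T := hP.δ_pos.trans_le hP.δ_le_T

lemma min_gain_pos (hP : P.Admissible) : 0 < min P.k₁ P.k₂ := by
  have hk₁ := gain_bound hP.p₁_pos hP.pq₁ hP.k₁_mem
  have hk₂ := gain_bound hP.p₂_pos hP.pq₂ hP.k₂_mem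
  refine lt_min ?_ ?_
  · nlinarith [hP.q₁_pos, mul_nonneg hP.p₁_pos.le (sq_nonneg P.k₁)]
  · nlinarith [hP.q₂_pos, mul_nonneg hP.p₂_pos.le (sq_nonneg P.k₂)]

/-- Within one sampling period the terminal controller leads from the disc of radius `r` into the
terminal disc. -/
lemma exp_mul_radius_le (hP : P.Admissible) {r L : ℝ} (hε : 0 < P.ε) (hr : 0 < r)
    (h_gain : log (r / P.ε) ≤ min P.k₁ P.k₂ * P.δ) (hL : P.δ ≤ L) :
    exp (-(min P.k₁ P.k₂ * L)) * r ≤ P.ε := by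
  have h1 : log (r / P.ε) ≤ min P.k₁ P.k₂ * L :=
    h_gain.trans (mul_le_mul_of_nonneg_left hL (min_gain_pos hP).le)
  have h2 := (log_le_iff_le_exp (by positivity)).1 h1
  rw [div_le_iff₀ hε] at h2
  rw [exp_neg, inv_mul_le_iff₀ (exp_pos _)]
  exact h2

lemma radius_le_stateBound {r : ℝ} (hr : 0 < r) {x : ℝ}
    (hx : x ∈ Ioc 0 P.T) : r ≤ r * P.T / x := by
  rw [le_div_iff₀ hx.1]
  exact mul_le_mul_of_nonneg_left hx.2 hr.le

/-- From a tracking error in the disc of radius `r` the terminal controller solves the constraints,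
at the cost of the terminal penalty. -/
theorem exists_feasible_of_norm_le_radius (hP : P.Admissible) (href : ref.Admissible P)
    (hε : 0 < P.ε) (hr : 0 < radius P ref)
    (h_gain : log (radius P ref / P.ε) ≤ min P.k₁ P.k₂ * P.δ) {s : ℝ} (hs : P.t₀ ≤ s) {ζ : E3}
    (hζ : ‖trackErr (ref.ξ s) ζ‖ ≤ radius P ref) :
    ∃ u ξ, IsFeasiblePair P ref s ζ u ξ ∧
      cost P ref s u ξ ≤ terminalCost (trackErr (ref.ξ s) ζ) := by
  have hT := hP.T_pos
  obtain ⟨u, x, harc, hxs, hdecay, hcost⟩ :=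
    exists_terminal_arc hP href hr hs (e := s + P.T) (by linarith) hζ
  refine ⟨u, x, ⟨harc.measurable, hxs, harc.solution, harc.input, fun τ hτ => ?_, ?_⟩, hcost⟩
  · have h1 := hdecay τ ⟨hτ.1.le, hτ.2⟩
    have h2 : exp (-(min P.k₁ P.k₂ * (τ - s))) ≤ 1 :=
      exp_le_one_iff.2 (by nlinarith [min_gain_pos hP, hτ.1])
    have h3 := radius_le_stateBound hr (x := τ - s) ⟨by linarith [hτ.1], by linarith [hτ.2]⟩
    exact (h1.trans (mul_le_of_le_one_left (norm_nonneg _) h2)).trans (hζ.trans h3)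
  · have h1 := hdecay (s + P.T) ⟨by linarith, le_rfl⟩
    rw [add_sub_cancel_left] at h1
    exact (h1.trans (mul_le_mul_of_nonneg_left hζ (exp_pos _).le)).trans
      (exp_mul_radius_le hP hε hr h_gain hP.δ_le_T)

/-- The rate at which a displacement of the measured state increases the cost of the shifted
candidate. -/
def perturbRate (P : Params) (r : ℝ) : ℝ :=
  P.T * ((P.q₁ + P.q₂) * (2 * (r * P.T / P.δ) + r)) + 2 * r

lemma perturbRate_nonneg (hP : P.Admissible) {r : ℝ} (hr : 0 < r) : 0 ≤ perturbRate P r := by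
  have := hP.T_pos
  have := hP.q₁_pos
  have := hP.q₂_pos
  have := hP.δ_pos
  unfold perturbRate
  positivity

/-- The shifted candidate: after one sampling period, when the measured position is displaced by at
most `D` from the predicted one, the rest of the input, followed by the terminal controller, is
feasible, and costs less by the running cost of that period, up to a multiple of `D`. -/
theorem IsFeasiblePair.exists_shifted (hP : P.Admissible) (href : ref.Admissible P)
    (hε : 0 < P.ε) (hεr : P.ε < radius P ref)
    (h_gain : log (radius P ref / P.ε) ≤ min P.k₁ P.k₂ * P.δ)
    (h_term : radius P ref * (P.T - P.δ) / P.T ≤ P.ε) {s : ℝ} (hs : P.t₀ ≤ s) {ζ ζ' : E3}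
    {u : ℝ → E2} {ξ : ℝ → E3} (h : IsFeasiblePair P ref s ζ u ξ) (hθ : ζ' 2 = ξ (s + P.δ) 2)
    {D : ℝ} (hD : ∀ ζr, ‖posErr ζr ζ' - posErr ζr (ξ (s + P.δ))‖ ≤ D)
    (hDr : D ≤ radius P ref - P.ε) :
    ∃ u' ξ', IsFeasiblePair P ref (s + P.δ) ζ' u' ξ' ∧
      cost P ref (s + P.δ) u' ξ' ≤ cost P ref s u ξ - runCost P ref u ξ s (s + P.δ)
        + perturbRate P (radius P ref) * D := by
  have hr : 0 < radius P ref := hε.trans hεr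
  set r := radius P ref with hr'
  have hT := hP.T_pos
  have hδ := hP.δ_pos
  have hδT := hP.δ_le_T
  have hD0 : 0 ≤ D := (norm_nonneg _).trans (hD 0)
  set c : E3 := ζ' - ξ (s + P.δ) with hc
  have hc2 : c 2 = 0 := by simp [hc, hθ]
  have hshift : ∀ τ, ‖trackErr (ref.ξ τ) (ξ τ + c) - trackErr (ref.ξ τ) (ξ τ)‖ ≤ D := by
    intro τ
    rw [norm_trackErr_sub (by simp [hc2])]
    have e : posErr (ref.ξ τ) (ξ τ + c) - posErr (ref.ξ τ) (ξ τ)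
        = posErr (ref.ξ τ) ζ' - posErr (ref.ξ τ) (ξ (s + P.δ)) := by
      ext i
      fin_cases i <;> simp [posErr, hc]
    rw [e]
    exact hD _
  have hshift' : ∀ τ, ‖trackErr (ref.ξ τ) (ξ τ + c)‖ ≤ ‖trackErr (ref.ξ τ) (ξ τ)‖ + D := by
    intro τ
    linarith [norm_sub_norm_le (trackErr (ref.ξ τ) (ξ τ + c)) (trackErr (ref.ξ τ) (ξ τ)),
      hshift τ]
  have hend : ‖trackErr (ref.ξ (s + P.T)) (ξ (s + P.T) + c)‖ ≤ r := by
    linarith [hshift' (s + P.T), h.terminal]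
  have harc := h.isArc.mono hP (a := s + P.δ) (b := s + P.T) (by linarith) le_rfl
  obtain ⟨v, x, hx, hxs, hdecay, hcost⟩ := exists_terminal_arc hP href hr
    (s := s + P.T) (e := s + P.δ + P.T) (by linarith) (by linarith) hend
  have hglue := (harc.add_const hc2).glue hx hP (by linarith) (by linarith) hxs.symm
  set u' := glue u v (s + P.T)
  set ξ' := glue (fun τ => ξ τ + c) x (s + P.T) with hξ'
  have hleft : ∀ τ ≤ s + P.T, ξ' τ = ξ τ + c := fun τ hτ => glue_of_le hτ
  have hright : ∀ τ, s + P.T ≤ τ → ξ' τ = x τ := fun τ hτ => glue_of_ge hxs.symm hτ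
  have hmin := min_gain_pos hP
  -- The displacement fits between the bounds `r T / (τ - s)` and `r T / (τ - s - δ)` of the state
  -- constraints at `s` and at `s + δ`, whose difference is smallest at the end of the horizon.
  have hDδ : D ≤ r * P.δ / P.T := by
    have : r * (P.T - P.δ) / P.T = r - r * P.δ / P.T := by field_simp
    linarith
  refine ⟨u', ξ', ⟨hglue.measurable, ?_, hglue.solution, hglue.input, fun τ hτ => ?_, ?_⟩, ?_⟩
  · rw [hleft _ (by linarith), hc]
    abel
  · have hy : 0 < τ - (s + P.δ) := by linarith [hτ.1]
    rcases le_or_gt τ (s + P.T) with hle | hlt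
    · rw [hleft τ hle]
      have h1 := h.state τ ⟨by linarith [hτ.1], hle⟩
      refine (hshift' τ).trans ?_
      have h2 : 0 < τ - s := by linarith [hτ.1]
      have h3 : r * P.T / (τ - (s + P.δ)) - r * P.T / (τ - s)
          = r * P.T * P.δ / ((τ - s) * (τ - (s + P.δ))) := by
        field_simp
        ring
      have h4 : r * P.δ / P.T ≤ r * P.T * P.δ / ((τ - s) * (τ - (s + P.δ))) := by
        rw [div_le_div_iff₀ hT (by positivity)]
        have : (τ - s) * (τ - (s + P.δ)) ≤ P.T * P.T :=
          mul_le_mul (by linarith) (by linarith) hy.le hT.le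
        calc _ ≤ r * P.δ * (P.T * P.T) := by gcongr
          _ = _ := by ring
      linarith
    · rw [hright τ hlt.le]
      have h1 := hdecay τ ⟨hlt.le, hτ.2⟩
      have h2 : exp (-(min P.k₁ P.k₂ * (τ - (s + P.T)))) ≤ 1 :=
        exp_le_one_iff.2 (by nlinarith)
      have h3 := radius_le_stateBound hr (x := τ - (s + P.δ)) ⟨hy, by linarith [hτ.2]⟩
      exact (h1.trans (mul_le_of_le_one_left (norm_nonneg _) h2)).trans (hend.trans h3)
  · rw [hright _ (by linarith)]
    have h1 := hdecay (s + P.δ + P.T) ⟨by linarith, le_rfl⟩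
    have e : s + P.δ + P.T - (s + P.T) = P.δ := by ring
    rw [e] at h1
    exact (h1.trans (mul_le_mul_of_nonneg_left hend (exp_pos _).le)).trans
      (exp_mul_radius_le hP hε hr h_gain le_rfl)
  · set B := r * P.T / P.δ with hB
    set C := (P.q₁ + P.q₂) * (2 * B * D + D ^ 2) with hC
    have hq : 0 ≤ P.q₁ + P.q₂ := add_nonneg hP.q₁_pos.le hP.q₂_pos.le
    have hmid : runCost P ref u (fun τ => ξ τ + c) (s + P.δ) (s + P.T)
        ≤ runCost P ref u ξ (s + P.δ) (s + P.T) + (P.T - P.δ) * C := by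
      have hi := harc.intervalIntegrable_stageCost hP href (by linarith) (by linarith)
      have h1 : runCost P ref u (fun τ => ξ τ + c) (s + P.δ) (s + P.T)
          ≤ ∫ τ in (s + P.δ)..(s + P.T), (stageCost P (trackErr (ref.ξ τ) (ξ τ))
            (inputErr P.ρ (ref.ξ τ) (ref.u τ) (ξ τ) (u τ)) + C) := by
        refine intervalIntegral.integral_mono_on (by linarith)
          ((harc.add_const hc2).intervalIntegrable_stageCost hP href (by linarith) (by linarith))
          (hi.add (by simp)) fun τ hτ => ?_
        simp only
        rw [inputErr_congr (ζ' := ξ τ + c) (ζ := ξ τ) (by simp [hc2])]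
        refine stageCost_le_add hP _ (hshift τ) ?_
        refine (h.state τ ⟨by linarith [hτ.1], hτ.2⟩).trans ?_
        exact div_le_div_of_nonneg_left (by positivity) hδ (by linarith [hτ.1])
      rw [intervalIntegral.integral_add hi (by simp), intervalIntegral.integral_const] at h1
      refine h1.trans (le_of_eq ?_)
      rw [smul_eq_mul, add_sub_add_left_eq_sub]
      rfl
    have hCD : (P.T - P.δ) * C ≤ P.T * ((P.q₁ + P.q₂) * (2 * B + r)) * D := by
      have h1 : C ≤ (P.q₁ + P.q₂) * (2 * B + r) * D := by
        have h2 : D ^ 2 ≤ r * D := by nlinarith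
        rw [hC, mul_assoc (P.q₁ + P.q₂)]
        refine mul_le_mul_of_nonneg_left ?_ hq
        nlinarith
      have h3 : 0 ≤ C := by positivity
      calc (P.T - P.δ) * C ≤ P.T * C := by nlinarith
        _ ≤ P.T * ((P.q₁ + P.q₂) * (2 * B + r) * D) := by gcongr
        _ = _ := by ring
    have hterm : terminalCost (trackErr (ref.ξ (s + P.T)) (ξ (s + P.T) + c))
        ≤ terminalCost (trackErr (ref.ξ (s + P.T)) (ξ (s + P.T))) + 2 * r * D := by
      simp only [terminalCost]
      have h1 := hshift' (s + P.T)
      have h2 := h.terminal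
      have h3 := pow_le_pow_left₀ (norm_nonneg _) h1 2
      have h4 := norm_nonneg (trackErr (ref.ξ (s + P.T)) (ξ (s + P.T)))
      nlinarith [mul_le_mul_of_nonneg_right (h2.trans hεr.le) hD0]
    have e1 : cost P ref (s + P.δ) u' ξ'
        = runCost P ref u (fun τ => ξ τ + c) (s + P.δ) (s + P.T)
          + runCost P ref v x (s + P.T) (s + P.δ + P.T)
          + terminalCost (trackErr (ref.ξ (s + P.δ + P.T)) (x (s + P.δ + P.T))) := by
      rw [← hright _ (by linarith), ← runCost_glue_left (u' := v) (ξ' := x) (by linarith),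
        ← runCost_glue_right (u := u) (ξ := fun τ => ξ τ + c) (u' := v) (ξ' := x)
          (m := s + P.T) (by linarith),
        ← hglue.runCost_add hP href (by linarith) (by linarith) (by linarith)]
      rfl
    have e2 : cost P ref s u ξ = runCost P ref u ξ s (s + P.δ)
        + runCost P ref u ξ (s + P.δ) (s + P.T)
        + terminalCost (trackErr (ref.ξ (s + P.T)) (ξ (s + P.T))) := by
      rw [← h.isArc.runCost_add hP href hs (by linarith) (by linarith)]
      rfl
    rw [e1, e2, perturbRate, add_mul, ← hB]
    linarith

/-- A bound of the cost of all feasible pairs, from bounds of the tracking and the input error. -/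
def costBound (P : Params) : ℝ :=
  P.T * ((P.q₁ + P.q₂) * (P.ε + 4 * P.a * P.T) ^ 2 + (P.p₁ + P.p₂) * (4 * P.a) ^ 2)
    + 1 / 2 * P.ε ^ 2

/-- The terminal constraint and the bounded speeds bound the cost of every feasible pair. -/
lemma IsFeasiblePair.cost_le (hP : P.Admissible) (href : ref.Admissible P) {s : ℝ}
    (hs : P.t₀ ≤ s) {ζ : E3} {u : ℝ → E2} {ξ : ℝ → E3} (h : IsFeasiblePair P ref s ζ u ξ) :
    cost P ref s u ξ ≤ costBound P := by
  have hT := hP.T_pos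
  have ha := hP.a_pos
  have harc := h.isArc
  have hw : ∀ τ ∈ Icc s (s + P.T),
      ‖inputErr P.ρ (ref.ξ τ) (ref.u τ) (ξ τ) (u τ)‖ ≤ 4 * P.a := fun τ hτ =>
    norm_inputErr_le ha hP.ρ_pos (harc.input τ hτ) (href.mem_U τ (hs.trans hτ.1)) _ _
  have hp : ∀ τ ∈ Icc s (s + P.T), ‖trackErr (ref.ξ τ) (ξ τ)‖ ≤ P.ε + 4 * P.a * P.T := by
    intro τ hτ
    have h1 := (harc.mono hP hτ.1 le_rfl).abs_norm_trackErr_sub_le hP href (hs.trans hτ.1) hτ.2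
    have h2 : ∫ σ in τ..(s + P.T), ‖inputErr P.ρ (ref.ξ σ) (ref.u σ) (ξ σ) (u σ)‖
        ≤ ∫ σ in τ..(s + P.T), 4 * P.a :=
      intervalIntegral.integral_mono_on hτ.2
        ((harc.mono hP hτ.1 le_rfl).intervalIntegrable_norm_inputErr hP href
          (hs.trans hτ.1) hτ.2) (by simp)
        fun σ hσ => hw σ ⟨hτ.1.trans hσ.1, hσ.2⟩
    rw [intervalIntegral.integral_const, smul_eq_mul] at h2
    have h3 := (abs_le.1 (h1.trans h2)).1
    have h4 : (s + P.T - τ) * (4 * P.a) ≤ P.T * (4 * P.a) :=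
      mul_le_mul_of_nonneg_right (by linarith [hτ.1]) (by positivity)
    linarith [h.terminal]
  have hrun : runCost P ref u ξ s (s + P.T) ≤ ∫ τ in s..(s + P.T),
      ((P.q₁ + P.q₂) * (P.ε + 4 * P.a * P.T) ^ 2 + (P.p₁ + P.p₂) * (4 * P.a) ^ 2) := by
    refine intervalIntegral.integral_mono_on (by linarith)
      (harc.intervalIntegrable_stageCost hP href hs (by linarith)) (by simp) fun τ hτ => ?_
    refine (stageCost_le hP _ _).trans ?_
    have := hP.q₁_pos
    have := hP.q₂_pos
    have := hP.p₁_pos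
    have := hP.p₂_pos
    gcongr
    · exact hp τ hτ
    · exact hw τ hτ
  rw [intervalIntegral.integral_const, smul_eq_mul, add_sub_cancel_left] at hrun
  have hterm : terminalCost (trackErr (ref.ξ (s + P.T)) (ξ (s + P.T))) ≤ 1 / 2 * P.ε ^ 2 := by
    have := pow_le_pow_left₀ (norm_nonneg _) h.terminal 2
    simp only [terminalCost]
    linarith
  exact add_le_add hrun hterm

/-- The optimal cost is at most quadratic in the initial tracking error: in the disc of radius `r` by
comparison with the terminal controller, outside because it is bounded. -/
lemma IsOptimalPair.cost_le (hP : P.Admissible) (href : ref.Admissible P)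
    (hε : 0 < P.ε) (hr : 0 < radius P ref)
    (h_gain : log (radius P ref / P.ε) ≤ min P.k₁ P.k₂ * P.δ) {s : ℝ} (hs : P.t₀ ≤ s) {ζ : E3}
    {u : ℝ → E2} {ξ : ℝ → E3} (h : IsOptimalPair P ref s ζ u ξ) :
    cost P ref s u ξ
      ≤ (1 / 2 + costBound P / radius P ref ^ 2) * ‖trackErr (ref.ξ s) ζ‖ ^ 2 := by
  have hM : 0 ≤ costBound P := by
    have := hP.q₁_pos
    have := hP.q₂_pos
    have := hP.p₁_pos
    have := hP.p₂_pos
    have := hP.T_pos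
    unfold costBound
    positivity
  rw [add_mul]
  rcases le_or_gt ‖trackErr (ref.ξ s) ζ‖ (radius P ref) with hle | hlt
  · obtain ⟨u', ξ', h1, h2⟩ := exists_feasible_of_norm_le_radius hP href hε hr h_gain hs hle
    have h3 : 0 ≤ costBound P / radius P ref ^ 2 * ‖trackErr (ref.ξ s) ζ‖ ^ 2 := by positivity
    have h4 := (h.2 u' ξ' h1).trans h2
    rw [terminalCost] at h4
    linarith
  · have h1 := h.1.cost_le hP href hs
    have h2 : costBound P ≤ costBound P / radius P ref ^ 2 * ‖trackErr (ref.ξ s) ζ‖ ^ 2 := by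
      rw [div_mul_eq_mul_div, le_div_iff₀ (by positivity)]
      gcongr
    have h3 : 0 ≤ 1 / 2 * ‖trackErr (ref.ξ s) ζ‖ ^ 2 := by positivity
    linarith

end

/-! ### Closed-loop trajectories and stability -/

section

variable {P : Params} {ref : Reference}

lemma Params.t_zero (P : Params) : P.t 0 = P.t₀ := by simp [Params.t]

lemma Params.t_succ (P : Params) (k : ℕ) : P.t (k + 1) = P.t k + P.δ := by
  simp only [Params.t]
  push_cast
  ring

lemma Params.Admissible.le_t (hP : P.Admissible) (k : ℕ) : P.t₀ ≤ P.t k := by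
  have := mul_nonneg k.cast_nonneg hP.δ_pos.le
  simp only [Params.t]
  linarith

/-- Every time of the run lies in a sampling period that has been carried out. -/
lemma Params.exists_mem_period (P : Params) {n : ℕ} (hn : 0 < n) {t : ℝ}
    (ht : t ∈ Icc P.t₀ (P.t n)) : ∃ k < n, t ∈ Icc (P.t k) (P.t (k + 1)) := by
  induction n with
  | zero => exact absurd hn (lt_irrefl 0)
  | succ n ih =>
    rcases le_or_gt (P.t n) t with hle | hlt
    · exact ⟨n, n.lt_succ_self, hle, ht.2⟩
    · have hn0 : 0 < n := by
        rcases Nat.eq_zero_or_pos n with rfl | h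
        · rw [P.t_zero] at hlt
          exact absurd ht.1 hlt.not_ge
        · exact h
      obtain ⟨k, hk, hkt⟩ := ih hn0 ⟨ht.1, hlt.le⟩
      exact ⟨k, hk.trans n.lt_succ_self, hkt⟩

lemma disturbance_le (hP : P.Admissible) {η r : ℝ} (hr : P.ε < r)
    (h_dist : η ≤ exp (-(P.a * P.T)) / P.δ * (r - P.ε)) : η * P.δ ≤ r - P.ε := by
  have hδ := hP.δ_pos
  have h1 : exp (-(P.a * P.T)) ≤ 1 :=
    exp_le_one_iff.2 (neg_nonpos.2 (mul_pos hP.a_pos hP.T_pos).le)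
  calc η * P.δ ≤ exp (-(P.a * P.T)) / P.δ * (r - P.ε) * P.δ := by gcongr
    _ = exp (-(P.a * P.T)) * (r - P.ε) := by field_simp
    _ ≤ 1 * (r - P.ε) := mul_le_mul_of_nonneg_right h1 (by linarith)
    _ = r - P.ε := one_mul _

/-- After a step of the algorithm the shifted candidate is feasible in the new measured state, and
costs less by the running cost of the step, up to a multiple of the disturbance level. -/
lemma exists_feasible_succ (hP : P.Admissible) (href : ref.Admissible P)
    (hε : 0 < P.ε) (hεr : P.ε < radius P ref)
    (h_gain : log (radius P ref / P.ε) ≤ min P.k₁ P.k₂ * P.δ)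
    (h_term : radius P ref * (P.T - P.δ) / P.T ≤ P.ε) {η : ℝ}
    (hηr : η * P.δ ≤ radius P ref - P.ε) {d : ℝ → E2} (hd : IsDisturbance P η d)
    {x ξ : ℝ → E3} {u : ℝ → E2} {k : ℕ} (h : IsFeasiblePair P ref (P.t k) (x (P.t k)) u ξ)
    (hx : IsSolution (fun σ y => headField P.ρ y (u σ) + !₂[d σ 0, d σ 1, 0])
      (P.t k) (P.t (k + 1)) x) :
    ∃ u' ξ', IsFeasiblePair P ref (P.t (k + 1)) (x (P.t (k + 1))) u' ξ' ∧
      cost P ref (P.t (k + 1)) u' ξ' ≤ cost P ref (P.t k) u ξ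
        - runCost P ref u ξ (P.t k) (P.t (k + 1))
        + perturbRate P (radius P ref) * (η * P.δ) := by
  have hδ := hP.δ_pos
  have harc := h.isArc.mono hP le_rfl (b := P.t (k + 1))
    (by rw [P.t_succ]; linarith [hP.δ_le_T])
  have hdev := harc.norm_posErr_sub_le_of_disturbed hP hd (hP.le_t k) hx h.initial.symm
    (τ := P.t (k + 1)) ⟨by rw [P.t_succ]; linarith, le_rfl⟩
  rw [P.t_succ] at hdev ⊢
  rw [add_sub_cancel_left] at hdev
  exact h.exists_shifted hP href hε hεr h_gain h_term (hP.le_t k) hdev.1 hdev.2 hηr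

/-- A sequence that is comparable with `m²` and decreases by a multiple of `m²`, up to a constant,
decays geometrically to a multiple of this constant. -/
lemma le_geometric_add {V m : ℕ → ℝ} {c C g : ℝ} {n : ℕ} (hc : 0 < c) (hC : 0 < C) (hg : 0 ≤ g)
    (hup : ∀ k < n, V k ≤ C * m k ^ 2)
    (hstep : ∀ k, k + 1 < n → V (k + 1) ≤ V k - c * m k ^ 2 + g) :
    ∀ k < n, V k ≤ (C / (C + c)) ^ k * (C * m 0 ^ 2) + (C + c) / c * g := by
  intro k
  induction k with
  | zero =>
    intro h0
    have : 0 ≤ (C + c) / c * g := by positivity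
    linarith [hup 0 h0]
  | succ k ih =>
    intro hk
    have h1 := ih (by omega)
    have h2 := hstep k hk
    have h3 := hup k (by omega)
    have h4 : V k - c * m k ^ 2 ≤ C / (C + c) * V k := by
      rw [div_mul_eq_mul_div, le_div_iff₀ (by positivity)]
      nlinarith [mul_le_mul_of_nonneg_left h3 hc.le, mul_nonneg (sq_nonneg c) (sq_nonneg (m k))]
    have h5 : C / (C + c) * ((C + c) / c * g) + g = (C + c) / c * g := by
      field_simp
    have h6 := mul_le_mul_of_nonneg_left h1 (show 0 ≤ C / (C + c) by positivity)
    rw [mul_add] at h6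
    rw [pow_succ']
    linarith [mul_assoc (C / (C + c)) ((C / (C + c)) ^ k) (C * m 0 ^ 2)]

lemma isClassKL_exp {A ν : ℝ} (hA : 0 < A) (hν : 0 < ν) :
    IsClassKL fun s t => A * s * exp (-(ν * t)) := by
  refine ⟨fun t _ => ⟨by fun_prop, fun x _ y _ hxy => ?_, by simp⟩, fun s hs => ⟨?_, ?_⟩⟩
  · have := exp_pos (-(ν * t))
    simp only
    gcongr
  · intro x _ y _ hxy
    simp only
    gcongr
  · have h1 : Tendsto (fun t : ℝ => exp (-(ν * t))) atTop (𝓝 0) :=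
      tendsto_exp_neg_atTop_nhds_zero.comp (tendsto_id.const_mul_atTop hν)
    simpa using h1.const_mul (A * s)

lemma isClassK_linear_add_sqrt {a b : ℝ} (ha : 0 < a) (hb : 0 ≤ b) :
    IsClassK fun x => a * x + b * √x := by
  refine ⟨by fun_prop, fun x _ y _ hxy => ?_, by simp⟩
  have h1 : a * x < a * y := by gcongr
  have h2 : b * √x ≤ b * √y := by gcongr
  simp only
  linarith

/-- With `V ≤ ρ ^ k C m² + G η` and `‖p‖ ≤ √(B V) + δ η`, the tracking error satisfies an
exponential estimate; the square root halves the rate, and the index `k` of the sampling period lags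
behind `τ / δ` by at most one, which costs the factor `1 / ρ`. -/
lemma le_exp_add_of_geometric {x V B C G ρ m η δ τ : ℝ} {k : ℕ} (hB : 0 ≤ B) (hC : 0 ≤ C)
    (hG : 0 ≤ G) (hρ : 0 < ρ) (hρ1 : ρ < 1) (hm : 0 ≤ m) (hη : 0 ≤ η) (hδ : 0 < δ)
    (hτ : τ ≤ (k + 1) * δ) (hV : V ≤ ρ ^ k * (C * m ^ 2) + G * η)
    (hx : x ≤ √(B * V) + δ * η) :
    x ≤ (1 + √(B * C / ρ)) * m * exp (-(-log ρ / (2 * δ) * τ))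
      + (δ * η + √(B * G) * √η) := by
  set E := exp (-(-log ρ / (2 * δ) * τ)) with hE
  have hlog : log ρ < 0 := log_neg hρ hρ1
  have hpow : ρ ^ k ≤ E ^ 2 / ρ := by
    rw [le_div_iff₀ hρ, ← pow_succ, hE, ← exp_nat_mul, ← rpow_natCast, rpow_def_of_pos hρ]
    refine exp_le_exp.2 ?_
    have h1 : ((2 : ℕ) : ℝ) * -(-log ρ / (2 * δ) * τ) = log ρ * (τ / δ) := by
      push_cast
      field_simp
    rw [h1]
    refine mul_le_mul_of_nonpos_left ?_ hlog.le
    rw [div_le_iff₀ hδ]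
    push_cast
    exact hτ
  have h1 : B * V ≤ (√(B * C / ρ) * m * E) ^ 2 + (√(B * G) * √η) ^ 2 := by
    rw [mul_pow, mul_pow, mul_pow, sq_sqrt (by positivity), sq_sqrt (by positivity), sq_sqrt hη]
    calc B * V ≤ B * (E ^ 2 / ρ * (C * m ^ 2) + G * η) := by
          gcongr
          exact hV.trans (by gcongr)
      _ = _ := by ring
  have h2 : √(B * V) ≤ √(B * C / ρ) * m * E + √(B * G) * √η := by
    have hEpos : 0 < E := exp_pos _
    refine sqrt_le_iff.2 ⟨by positivity, h1.trans ?_⟩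
    have : 0 ≤ (√(B * C / ρ) * m * E) * (√(B * G) * √η) := by positivity
    nlinarith
  have h3 : 0 ≤ m * E := mul_nonneg hm (exp_pos _).le
  nlinarith

/-- Input-to-state stability: the optimal cost at the sampling instants is comparable with the
squared tracking error and decreases by a multiple of it, up to a multiple of the disturbance
level. -/
theorem isISS (P : Params) (ref : Reference) (η : ℝ)
    (hP : P.Admissible) (href : ref.Admissible P)
    (hε : 0 < P.ε) (hεr : P.ε < radius P ref)
    (hηr : η * P.δ ≤ radius P ref - P.ε)
    (h_gain : log (radius P ref / P.ε) ≤ min P.k₁ P.k₂ * P.δ)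
    (h_term : radius P ref * (P.T - P.δ) / P.T ≤ P.ε) : IsISS P ref η := by
  have hδ := hP.δ_pos
  have hr : 0 < radius P ref := hε.trans hεr
  have hw := minWeight_pos hP
  set c := minWeight P * P.δ / (2 * (1 + P.δ ^ 2)) with hc
  have hc0 : 0 < c := by positivity
  set C := 1 / 2 + costBound P / radius P ref ^ 2 with hC
  have hC0 : 0 < C := by
    have := hP.q₁_pos
    have := hP.q₂_pos
    have := hP.p₁_pos
    have := hP.p₂_pos
    have := hP.T_pos
    rw [hC, costBound]
    positivity
  set B := 2 / c + 2 * P.δ / minWeight P with hB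
  have hB0 : 0 < B := by positivity
  set g := perturbRate P (radius P ref) * P.δ with hg
  have hg0 : 0 ≤ g := mul_nonneg (perturbRate_nonneg hP hr) hδ.le
  set q := C / (C + c) with hq
  have hq0 : 0 < q := by positivity
  have hq1 : q < 1 := (div_lt_one (by positivity)).2 (by linarith)
  have hν : 0 < -log q / (2 * P.δ) := by
    have := log_neg hq0 hq1
    exact div_pos (by linarith) (by positivity)
  have hG0 : 0 ≤ (C + c) / c * g := by positivity
  refine ⟨_, _, isClassKL_exp (A := 1 + √(B * C / q)) (by positivity) hν,
    isClassK_linear_add_sqrt hδ (sqrt_nonneg (B * ((C + c) / c * g))), ?_⟩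
  intro η' hη' d x hd _ n hrun t ht
  rcases Nat.eq_zero_or_pos n with rfl | hn
  · rw [P.t_zero] at ht
    have ht0 : t = P.t₀ := le_antisymm ht.2 ht.1
    have h1 := mul_nonneg (sqrt_nonneg (B * C / q)) (norm_nonneg (trackErr (ref.ξ t) (x t)))
    have h2 := mul_nonneg hδ.le hη'.1
    have h3 := mul_nonneg (sqrt_nonneg (B * ((C + c) / c * g))) (sqrt_nonneg η')
    simp only [← ht0, sub_self, mul_zero, neg_zero, exp_zero, mul_one]
    linarith
  have hη'r : η' * P.δ ≤ radius P ref - P.ε :=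
    (mul_le_mul_of_nonneg_right hη'.2 hδ.le).trans hηr
  choose! u ξ hopt hsol using hrun
  have harc : ∀ k < n, IsArc P (u k) (ξ k) (P.t k) (P.t (k + 1)) := fun k hk =>
    (hopt k hk).1.isArc.mono hP le_rfl (by rw [P.t_succ]; linarith [hP.δ_le_T])
  have hmono : ∀ k, P.t k ≤ P.t (k + 1) := fun k => by rw [P.t_succ]; linarith
  have hlen : ∀ k, P.t (k + 1) - P.t k = P.δ := fun k => by rw [P.t_succ]; ring
  set V : ℕ → ℝ := fun k => cost P ref (P.t k) (u k) (ξ k) with hV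
  set m : ℕ → ℝ := fun k => ‖trackErr (ref.ξ (P.t k)) (x (P.t k))‖ with hm
  have hlow : ∀ k < n, c * m k ^ 2 ≤ runCost P ref (u k) (ξ k) (P.t k) (P.t (k + 1)) := by
    intro k hk
    have h1 := (harc k hk).mul_norm_sq_le_runCost hP href (hP.le_t k) (hmono k)
    rwa [hlen, (hopt k hk).1.initial] at h1
  have hrunV : ∀ k < n, runCost P ref (u k) (ξ k) (P.t k) (P.t (k + 1)) ≤ V k := by
    intro k hk
    have hle : P.t (k + 1) ≤ P.t k + P.T := by rw [P.t_succ]; linarith [hP.δ_le_T]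
    have h1 := (hopt k hk).1.isArc.runCost_add hP href (hP.le_t k) (hmono k) hle
    have h2 : 0 ≤ runCost P ref (u k) (ξ k) (P.t (k + 1)) (P.t k + P.T) :=
      runCost_nonneg hP hle
    have h3 : V k = runCost P ref (u k) (ξ k) (P.t k) (P.t k + P.T)
      + terminalCost (trackErr (ref.ξ (P.t k + P.T)) (ξ k (P.t k + P.T))) := rfl
    have h4 : 0 ≤ terminalCost (trackErr (ref.ξ (P.t k + P.T)) (ξ k (P.t k + P.T))) := by
      unfold terminalCost
      positivity
    linarith
  have hup : ∀ k < n, V k ≤ C * m k ^ 2 := fun k hk =>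
    (hopt k hk).cost_le hP href hε hr h_gain (hP.le_t k)
  have hstep : ∀ k, k + 1 < n → V (k + 1) ≤ V k - c * m k ^ 2 + g * η' := by
    intro k hk
    have hk' : k < n := by omega
    obtain ⟨u', ξ', h1, h2⟩ := exists_feasible_succ hP href hε hεr h_gain h_term hη'r hd
      (hopt k hk').1 (hsol k hk')
    have h3 := (hopt (k + 1) hk).2 u' ξ' h1
    have h4 := hlow k hk'
    have h5 : perturbRate P (radius P ref) * (η' * P.δ) = g * η' := by rw [hg]; ring
    simp only [hV]
    linarith
  have hgeo := le_geometric_add hc0 hC0 (mul_nonneg hg0 hη'.1) hup hstep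
  obtain ⟨k, hk, hkt⟩ := P.exists_mem_period hn ht
  have hx : ‖trackErr (ref.ξ t) (x t)‖ ≤ √(B * V k) + P.δ * η' := by
    have h1 := ((harc k hk).norm_posErr_sub_le_of_disturbed hP hd (hP.le_t k) (hsol k hk)
      (hopt k hk).1.initial.symm hkt).2 (ref.ξ t)
    have h2 := (harc k hk).norm_sq_le_of_runCost hP href (hP.le_t k) hkt
    rw [hlen, (hopt k hk).1.initial] at h2
    have h3 : ‖trackErr (ref.ξ t) (ξ k t)‖ ≤ √(B * V k) := by
      refine le_sqrt_of_sq_le (h2.trans ?_)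
      have h4 := hrunV k hk
      have h5 : m k ^ 2 ≤ V k / c := by
        rw [le_div_iff₀ hc0]
        linarith [hlow k hk]
      have h6 := mul_le_mul_of_nonneg_left h4 (show 0 ≤ 2 * P.δ / minWeight P by positivity)
      calc _ ≤ 2 * (V k / c) + 2 * P.δ / minWeight P * V k := by linarith
        _ = B * V k := by rw [hB]; ring
    have h4 : η' * (t - P.t k) ≤ P.δ * η' := by
      rw [mul_comm P.δ]
      exact mul_le_mul_of_nonneg_left (by linarith [hkt.2, hlen k]) hη'.1
    rw [norm_trackErr] at h3 ⊢
    linarith [norm_sub_norm_le (posErr (ref.ξ t) (x t)) (posErr (ref.ξ t) (ξ k t))]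
  have hgk := hgeo k hk
  rw [← mul_assoc] at hgk
  have hm0 : m 0 = ‖trackErr (ref.ξ P.t₀) (x P.t₀)‖ := by simp only [hm, P.t_zero]
  rw [← hm0]
  refine le_exp_add_of_geometric hB0.le hC0.le hG0 hq0 hq1 (norm_nonneg _) hη'.1 hδ
    (k := k) (V := V k) ?_ ?_ hx
  · have h1 := hkt.2
    simp only [Params.t] at h1
    push_cast at h1
    linarith
  · simpa only [mul_assoc] using hgk

end

end NRMPC

end

theorem theorem2 (P : NRMPC.Params) (ref : NRMPC.Reference) (η : ℝ)
    (hP : P.Admissible) (href : ref.Admissible P) (hη : 0 ≤ η)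
    (hε : 0 < P.ε) (hεr : P.ε < NRMPC.radius P ref)
    (h_dist : η ≤ exp (-(P.a * P.T)) / P.δ * (NRMPC.radius P ref - P.ε))
    (h_gain : log (NRMPC.radius P ref / P.ε) ≤ min P.k₁ P.k₂ * P.δ)
    (h_term : NRMPC.radius P ref * (P.T - P.δ) / P.T ≤ P.ε) :
    (∀ (d : ℝ → NRMPC.E2) (ξ : ℝ → NRMPC.E3), NRMPC.IsDisturbance P η d →
      NRMPC.Feasible P ref P.t₀ (ξ P.t₀) →
      ∀ n, NRMPC.IsRun P ref d ξ n → NRMPC.Feasible P ref (P.t n) (ξ (P.t n))) ∧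
    (1 / 2 * η * exp (P.a * P.T) * (NRMPC.radius P ref + P.ε)
        + NRMPC.qNorm P ^ 2 * η ^ 2 * P.δ / (2 * P.a)
          * (exp (2 * P.a * P.T) - exp (2 * P.a * P.δ))
        + 2 * NRMPC.qNorm P ^ 2 * η * NRMPC.radius P ref / (√2 * P.a)
          * √(P.T ^ 2 / P.δ - P.T) * √(exp (2 * P.a * P.T) - exp (2 * P.a * P.δ))
        < min P.q₁ P.q₂ * P.ε ^ 2 →
      NRMPC.IsISS P ref η) := by
  have hηr := NRMPC.disturbance_le hP hεr h_dist
  refine ⟨fun d ξ hd h0 n hrun => ?_, fun _ =>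
    NRMPC.isISS P ref η hP href hε hεr hηr h_gain h_term⟩
  cases n with
  | zero => rwa [P.t_zero]
  | succ n =>
    obtain ⟨u, ξn, hopt, hsol⟩ := hrun n n.lt_succ_self
    obtain ⟨u', ξ', h, -⟩ := NRMPC.exists_feasible_succ hP href hε hεr h_gain h_term hηr hd
      hopt.1 hsol
    exact ⟨u', ξ', h⟩
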